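/- Work in the language of arithmetic $\{+,\cdot,<,0,1\}$. Let $\mathcal M\models \mathrm I\Sigma_1$ (that is, $\mathrm{PA}^-$ together with induction for $\Sigma_1$-formulas with parameters), with universe $M$. Write $x\mathrel{\mathrm E}y$ for Ackermann's membership relation "the $x$-th bit of the binary expansion of $y$ is $1$". A set $X\subseteq M$ is *coded* in $\mathcal M$ by $\alpha\in M$ if $X=\{x\in M:\mathcal M\models x\mathrel{\mathrm E}\alpha\}$, and similarly for submodels of $\mathcal M$. A coded function is a single-valued coded set of ordered pairs; a sequence number is a coded function with domain $\{i:i<l\}$ for some $l$, and $(a)_i$ is the $i$-th entry of the sequence number $a$ (with $(a)_i=0$ if $a$ is not a sequence number or $i$ is not below its length). A cut of $\mathcal M$ is a nonempty initial segment closed under successor. A cut $I$ is *strong* if for every coded function $f$ of $\mathcal M$ whose domain contains $I$ there is $e\in M$ with $e>I$ such that, for all $i\in I$, $f(i)\in I$ iff $f(i)<e$. **Lemma 3.3.** Let $\mathcal M\models \mathrm I\Sigma_1$, let $I$ be a strong cut of $\mathcal M$, and let $a\in M\setminus I$ be such that $(a)_i\neq (a)_j$ for all distinct $i,j\in I$.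 Suppose that $M_0=\{(a)_i: i\in I\}$ is the universe of a $\Sigma_1$-elementary submodel $\mathcal M_0$ of $\mathcal M$. Let $X\subseteq M_0$ be coded in $\mathcal M$, and let $i_0\in I$ be such that $i<i_0$ for every $i\in I$ with $(a)_i\in X$. Then $X$ is coded in $\mathcal M_0$; that is, there is $\alpha\in M_0$ which codes $X$ in $\mathcal M_0$, and this $\alpha$ also codes $X$ in $\mathcal M$. -/

import Mathlib

namespace Arith

open FirstOrder FirstOrder.Language

/-! ### The language of arithmetic `{+, ·, <, 0, 1}` -/

inductive Func : ℕ → Type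
  | zero : Func 0
  | one : Func 0
  | add : Func 2
  | mul : Func 2

inductive Rel : ℕ → Type
  | lt : Rel 2

/-- The language of arithmetic. -/
def LA : FirstOrder.Language.{0, 0} := ⟨Func, Rel⟩

abbrev zeroSymb : LA.Functions 0 := Func.zero

abbrev oneSymb : LA.Functions 0 := Func.one

abbrev addSymb : LA.Functions 2 := Func.add

abbrev mulSymb : LA.Functions 2 := Func.mul

abbrev ltSymb : LA.Relations 2 := Rel.lt

section Operations

variable {M : Type*} [LA.Structure M]

instance (priority := 50) instZero : Zero M :=
  ⟨Structure.funMap zeroSymb ![]⟩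

instance (priority := 50) instOne : One M :=
  ⟨Structure.funMap oneSymb ![]⟩

instance (priority := 50) instAdd : Add M :=
  ⟨fun x y => Structure.funMap addSymb ![x, y]⟩

instance (priority := 50) instMul : Mul M :=
  ⟨fun x y => Structure.funMap mulSymb ![x, y]⟩

instance (priority := 50) instLT : LT M :=
  ⟨fun x y => Structure.RelMap ltSymb ![x, y]⟩

end Operations

/-! ### `Δ₀` and `Σ₁` formulas -/

/-- The atomic formula `s < t`. -/
def ltFormula {α : Type} {n : ℕ} (s t : LA.Term (α ⊕ Fin n)) : LA.BoundedFormula α n :=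
  ltSymb.boundedFormula₂ s t

/-- The formula `xₙ < t`, where `xₙ` is the next variable to be quantified; `t` is a term in the
earlier variables only. -/
def newLt {α : Type} {n : ℕ} (t : LA.Term (α ⊕ Fin n)) : LA.BoundedFormula α (n + 1) :=
  ltFormula (Term.var (Sum.inr (Fin.last n))) (t.relabel (Sum.map id Fin.castSucc))

/-- `Δ₀`-formulas: built from atomic formulas by propositional connectives (all of which Mathlib
writes through `⊥` and `→`) and the bounded quantifiers `∀ x < t` and `∃ x < t`. -/
inductive IsDelta0 {α : Type} : ∀ {n : ℕ}, LA.BoundedFormula α n → Prop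
  | falsum {n : ℕ} : IsDelta0 (⊥ : LA.BoundedFormula α n)
  | atomic {n : ℕ} {φ : LA.BoundedFormula α n} (h : φ.IsAtomic) : IsDelta0 φ
  | imp {n : ℕ} {φ ψ : LA.BoundedFormula α n} (hφ : IsDelta0 φ) (hψ : IsDelta0 ψ) :
      IsDelta0 (φ.imp ψ)
  | ball {n : ℕ} (t : LA.Term (α ⊕ Fin n)) {φ : LA.BoundedFormula α (n + 1)}
      (hφ : IsDelta0 φ) : IsDelta0 ((newLt t).imp φ).all
  | bex {n : ℕ} (t : LA.Term (α ⊕ Fin n)) {φ : LA.BoundedFormula α (n + 1)}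
      (hφ : IsDelta0 φ) : IsDelta0 (newLt t ⊓ φ).ex

/-- `Σ₁`-formulas: a block of existential quantifiers in front of a `Δ₀`-formula. -/
inductive IsSigma1 {α : Type} : ∀ {n : ℕ}, LA.BoundedFormula α n → Prop
  | delta0 {n : ℕ} {φ : LA.BoundedFormula α n} (h : IsDelta0 φ) : IsSigma1 φ
  | ex {n : ℕ} {φ : LA.BoundedFormula α (n + 1)} (h : IsSigma1 φ) : IsSigma1 φ.ex

/-! ### Models of `IΣ₁` and `Σ₁`-elementary submodels -/

/-- `M ⊨ PA⁻`: the axioms of the nonnegative part of a discretely ordered ring. -/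
structure ModelsPAMinus (M : Type*) [LA.Structure M] : Prop where
  add_assoc : ∀ x y z : M, (x + y) + z = x + (y + z)
  add_comm : ∀ x y : M, x + y = y + x
  mul_assoc : ∀ x y z : M, (x * y) * z = x * (y * z)
  mul_comm : ∀ x y : M, x * y = y * x
  mul_add : ∀ x y z : M, x * (y + z) = x * y + x * z
  add_zero : ∀ x : M, x + 0 = x
  mul_zero : ∀ x : M, x * 0 = 0
  mul_one : ∀ x : M, x * 1 = x
  lt_trans : ∀ x y z : M, x < y → y < z → x < z
  lt_irrefl : ∀ x : M, ¬ x < x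
  lt_trichotomy : ∀ x y : M, x < y ∨ x = y ∨ y < x
  add_lt_add_right : ∀ x y z : M, x < y → x + z < y + z
  mul_lt_mul_right : ∀ x y z : M, 0 < z → x < y → x * z < y * z
  exists_add_of_lt : ∀ x y : M, x < y → ∃ z : M, x + z = y
  zero_lt_one : (0 : M) < 1
  discrete : ∀ x : M, 0 < x → x = 1 ∨ 1 < x
  nonneg : ∀ x : M, x = 0 ∨ 0 < x

/-- `M ⊨ IΣ₁`: `PA⁻` together with induction for every `Σ₁`-formula `φ(x, v₀, v₁, …)`; the free
variables `v₀, v₁, …` are the parameters. -/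
structure ModelsISigma1 (M : Type*) [LA.Structure M] : Prop where
  paMinus : ModelsPAMinus M
  induction : ∀ φ : LA.BoundedFormula ℕ 1, IsSigma1 φ → ∀ v : ℕ → M,
    φ.Realize v ![0] →
    (∀ x : M, φ.Realize v ![x] → φ.Realize v ![x + 1]) →
    ∀ x : M, φ.Realize v ![x]

/-- `M₀ ≺_{Σ₁} M`. -/
def IsSigma1Elementary {M : Type*} [LA.Structure M] (M₀ : LA.Substructure M) : Prop :=
  ∀ φ : LA.Formula ℕ, IsSigma1 φ → ∀ v : ℕ → M₀,
    φ.Realize v ↔ φ.Realize (fun k => (v k : M))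

/-! ### Coding of finite sets, functions and sequences

The relations below are the interpretations, in an arbitrary structure for the language of
arithmetic, of the usual formulas; they make sense both in a model and in its submodels. Exponentiation is written through the
`Σ₁`-formula that expresses the recursion `2 ^ 0 = 1`, `2 ^ (x + 1) = 2 · 2 ^ x`; in models of `IΣ₁`
and in their `Σ₁`-elementary submodels it defines the same relation as the `Δ₀`-formulas for the
graph of `2 ^ x`. -/

section Coding

variable {M : Type*} [LA.Structure M]

/-- Gödel's `β`-function: `z` is the remainder of `c` modulo `1 + (i + 1) d`. -/
def Beta (c d i z : M) : Prop :=
  z < 1 + (i + 1) * d ∧ ∃ q : M, q < c + 1 ∧ c = q * (1 + (i + 1) * d) + z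

/-- `y = 2 ^ x`: there is a (`β`-coded) sequence which starts with `1`, doubles at each of its
`x` steps and ends with `y`. -/
def PowTwo (x y : M) : Prop :=
  ∃ c d : M, Beta c d 0 1 ∧
    (∀ i : M, i < x → ∃ z : M, z < c + 1 ∧ Beta c d i z ∧ Beta c d (i + 1) (z + z)) ∧
    Beta c d x y

/-- Ackermann membership `x E y`: the `x`-th bit of the binary expansion of `y` is `1`, i.e.
`y = (2 q + 1) 2 ^ x + r` with `r < 2 ^ x`. -/
def AckMem (x y : M) : Prop :=
  ∃ p : M, PowTwo x p ∧
    ∃ q r : M, q < y + 1 ∧ r < p ∧ y = (q + q + 1) * p + r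

/-- `α` codes `X` in `M`: `X` is the set of Ackermann members of `α`. -/
def Codes (α : M) (X : Set M) : Prop :=
  ∀ x : M, x ∈ X ↔ AckMem x α

/-- `X` is coded in `M`. -/
def IsCoded (X : Set M) : Prop :=
  ∃ α : M, Codes α X

/-- `p` is the (Cantor) ordered pair `⟨x, y⟩ = (x + y) (x + y + 1) / 2 + y`. -/
def IsPair (x y p : M) : Prop :=
  p + p = (x + y) * (x + y + 1) + (y + y)

/-- The pair `⟨x, y⟩` belongs to the set coded by `f`; for a coded function, `f(x) = y`. -/
def App (f x y : M) : Prop :=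
  ∃ p : M, IsPair x y p ∧ AckMem p f

/-- `f` is (the code of) a coded function: a coded set of ordered pairs which is single-valued.
(Every element is an ordered pair.) -/
def IsCodedFun (f : M) : Prop :=
  ∀ x y y' : M, App f x y → App f x y' → y = y'

/-- `a` is a sequence number: a coded function whose domain is `{i : i < l}` for some `l`,
the length of `a`. -/
def IsSeq (a : M) : Prop :=
  IsCodedFun a ∧ ∃ l : M, ∀ i : M, (∃ z : M, App a i z) ↔ i < l

open Classical in
/-- `(a)ᵢ`, the `i`-th entry of the sequence number `a`; it is `0` if `a` is not a sequence
number or `i` is not less than its length. -/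
noncomputable def entry (a i : M) : M :=
  if h : IsSeq a ∧ ∃ z : M, App a i z then h.2.choose else 0

/-! ### Cuts -/

/-- A cut: a nonempty initial segment closed under successor. -/
structure IsCut (I : Set M) : Prop where
  nonempty : I.Nonempty
  initial : ∀ x y : M, x < y → y ∈ I → x ∈ I
  succ : ∀ x : M, x ∈ I → x + 1 ∈ I

/-- A strong cut: for every coded function `f` whose domain contains `I` there is `e > I` such that
for all `i ∈ I`, `f(i) ∈ I` iff `f(i) < e`. (No coded function is total on a model of `IΣ₁`, so the
condition says something only for proper cuts.) -/
structure IsStrongCut (I : Set M) : Prop extends IsCut I where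
  strong : ∀ f : M, IsCodedFun f → (∀ i ∈ I, ∃ y : M, App f i y) →
    ∃ e : M, (∀ i ∈ I, i < e) ∧ ∀ i ∈ I, ∀ y : M, App f i y → (y ∈ I ↔ y < e)

end Coding

end Arith

/-! For `k ≤ i₀` let `Xₖ` be the set of those elements of `X` that occur among the first `k` entries
of `a`. Then `X₀` is empty and `X_{i₀} = X`, so it is enough to show by induction on `k` that `Xₖ`
has a code in `M₀`. The step is easy. If `β ∈ M₀` codes `Xₖ`, then `Xₖ₊₁` is coded by `β` or by `β +
2 ^ (a)ₖ`, and `M₀` is closed under addition and, being `Σ₁`-elementary, under powers of two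
(`CodesInitial.succ`, `IsSigma1Elementary.exists_powTwo`).

The difficulty is that "`Xₖ` has a code in `M₀`" means "some `(a)ⱼ` with `j ∈ I` codes `Xₖ`", and
`I` need not be definable. Strength of `I` removes it. Let `f(k)` be the least `j` such that `(a)ⱼ`
codes `Xₖ`, or `a` if there is none; `f` is a coded function (`exists_leastIndex`). Strength gives
`e > I` such that `f(k) ∈ I` iff `f(k) < e` for `k ∈ I`. Hence for these `k` the property is
equivalent to "some `(a)ⱼ` with `j < e` codes `Xₖ`", which is `Δ₁`, and `Σ₁`-induction applies
(`exists_code_mem`). Since `E` is `Σ₁`, the code found also works inside `M₀`.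

The rest is the arithmetic of `IΣ₁` that this needs: closure properties of `Σ₁` and `Δ₁` relations,
the `β`-function (`exists_beta`), totality of `2 ^ x`, the effect of adding `2 ^ x` on bits
(`ackMem_add_exp`), and bounded `Δ₁`-comprehension (`exists_code`). -/

namespace Arith

open FirstOrder FirstOrder.Language

set_option linter.unusedSectionVars false

/-! ### The discretely ordered semiring of a model of `IΣ₁` -/

section Algebra

variable {M : Type*} [LA.Structure M] [hM : Fact (ModelsISigma1 M)]

instance : CommSemiring M where
  add_assoc := hM.out.paMinus.add_assoc
  zero_add x := by rw [hM.out.paMinus.add_comm]; exact hM.out.paMinus.add_zero x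
  add_zero := hM.out.paMinus.add_zero
  add_comm := hM.out.paMinus.add_comm
  mul_assoc := hM.out.paMinus.mul_assoc
  mul_comm := hM.out.paMinus.mul_comm
  left_distrib := hM.out.paMinus.mul_add
  right_distrib x y z := by
    rw [hM.out.paMinus.mul_comm, hM.out.paMinus.mul_add, hM.out.paMinus.mul_comm z x,
      hM.out.paMinus.mul_comm z y]
  zero_mul x := by rw [hM.out.paMinus.mul_comm]; exact hM.out.paMinus.mul_zero x
  mul_zero := hM.out.paMinus.mul_zero
  one_mul x := by rw [hM.out.paMinus.mul_comm]; exact hM.out.paMinus.mul_one x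
  mul_one := hM.out.paMinus.mul_one
  nsmul := nsmulRec
  npow := npowRec

open Classical in
noncomputable instance : LinearOrder M where
  le x y := x < y ∨ x = y
  le_refl x := Or.inr rfl
  le_trans x y z := by
    rintro (h | rfl) (h' | rfl)
    · exact Or.inl (hM.out.paMinus.lt_trans _ _ _ h h')
    · exact Or.inl h
    · exact Or.inl h'
    · exact Or.inr rfl
  lt_iff_le_not_ge x y := by
    constructor
    · refine fun h => ⟨Or.inl h, ?_⟩
      rintro (h' | rfl)
      · exact hM.out.paMinus.lt_irrefl _ (hM.out.paMinus.lt_trans _ _ _ h h')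
      · exact hM.out.paMinus.lt_irrefl _ h
    · rintro ⟨h | rfl, h'⟩
      · exact h
      · exact absurd (Or.inr rfl) h'
  le_antisymm x y := by
    rintro (h | rfl) (h' | h')
    · exact absurd (hM.out.paMinus.lt_trans _ _ _ h h') (hM.out.paMinus.lt_irrefl _)
    · exact h'.symm
    · rfl
    · rfl
  le_total x y := by
    rcases hM.out.paMinus.lt_trichotomy x y with h | h | h
    · exact Or.inl (Or.inl h)
    · exact Or.inl (Or.inr h)
    · exact Or.inr (Or.inl h)
  toDecidableLE := Classical.decRel _

instance : IsOrderedCancelAddMonoid M :=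
  have key : ∀ x y z : M, x < y → x + z < y + z := hM.out.paMinus.add_lt_add_right
  { add_le_add_left := fun x y h z => by
      rcases h.lt_or_eq with h | rfl
      · exact (key x y z h).le
      · exact le_rfl
    le_of_add_le_add_left := fun x y z h => by
      by_contra! h'
      have := key z y x h'
      rw [add_comm z, add_comm y] at this
      exact absurd h this.not_ge }

instance : IsStrictOrderedRing M :=
  have key : ∀ x y z : M, 0 < z → x < y → x * z < y * z := hM.out.paMinus.mul_lt_mul_right
  { zero_le_one := (show (0 : M) < 1 from hM.out.paMinus.zero_lt_one).le
    exists_pair_ne := ⟨0, 1, (show (0 : M) < 1 from hM.out.paMinus.zero_lt_one).ne⟩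
    mul_lt_mul_of_pos_left := fun z hz x y h => by
      have := key x y z hz h
      rwa [mul_comm x, mul_comm y] at this
    mul_lt_mul_of_pos_right := fun z hz x y h => key x y z hz h }

lemma eq_zero_or_pos' (x : M) : x = 0 ∨ 0 < x := hM.out.paMinus.nonneg x

instance : CanonicallyOrderedAdd M :=
  have nn : ∀ x : M, 0 ≤ x := fun x => (eq_zero_or_pos' x).elim (fun h => h.symm.le) le_of_lt
  { exists_add_of_le := fun {x y} h => by
      rcases h.lt_or_eq with h | rfl
      · obtain ⟨z, hz⟩ := hM.out.paMinus.exists_add_of_lt x y h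
        exact ⟨z, hz.symm⟩
      · exact ⟨0, (add_zero x).symm⟩
    le_self_add := fun x y => by simpa using add_le_add_right (nn y) x
    le_add_self := fun x y => by simpa using add_le_add_left (nn y) x }

lemma one_le_of_pos {x : M} (h : 0 < x) : 1 ≤ x :=
  (hM.out.paMinus.discrete x h).elim (fun h => h.symm.le) le_of_lt

lemma lt_succ_iff {x y : M} : x < y + 1 ↔ x ≤ y := by
  refine ⟨fun h => ?_, fun h => lt_of_le_of_lt h (lt_add_of_pos_right y one_pos)⟩
  by_contra! h'
  obtain ⟨z, rfl⟩ := exists_add_of_le h'.le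
  have hz : 0 < z := pos_of_lt_add_right h'
  exact absurd h (not_lt.2 (add_le_add_right (one_le_of_pos hz) y))

lemma succ_le_iff {x y : M} : x + 1 ≤ y ↔ x < y := by
  rw [← lt_succ_iff, add_lt_add_iff_right]

lemma exists_eq_succ {x : M} (h : 0 < x) : ∃ y, x = y + 1 := by
  obtain ⟨y, rfl⟩ := exists_add_of_le (one_le_of_pos h)
  exact ⟨y, add_comm _ _⟩

end Algebra

/-! ### Substitution in `Δ₀`-formulas -/

lemma realize_newLt {M : Type*} [LA.Structure M] {n : ℕ} (τ : LA.Term (ℕ ⊕ Fin n)) (v : ℕ → M)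
    (xs : Fin n → M) (x : M) :
    (newLt τ).Realize v (Fin.snoc xs x) ↔ x < τ.realize (Sum.elim v xs) := by
  rw [newLt, ltFormula, BoundedFormula.realize_rel₂, Term.realize_relabel]
  have h : (Sum.elim v (Fin.snoc xs x : Fin (n + 1) → M)) ∘ Sum.map id Fin.castSucc =
      Sum.elim v xs := by
    funext y
    rcases y with y | y <;> simp
  rw [h]
  simp only [Term.realize_var, Sum.elim_inr, Fin.snoc_last]
  rfl

/-- Substitution of terms for variables, extended to the variable of a new quantifier. -/
def substSnoc {n m : ℕ} (σ : ℕ ⊕ Fin n → LA.Term (ℕ ⊕ Fin m)) :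
    ℕ ⊕ Fin (n + 1) → LA.Term (ℕ ⊕ Fin (m + 1)) :=
  Sum.elim (fun k => (σ (Sum.inl k)).relabel (Sum.map id Fin.castSucc))
    (Fin.snoc (fun i => (σ (Sum.inr i)).relabel (Sum.map id Fin.castSucc))
      (Term.var (Sum.inr (Fin.last m))))

lemma realize_substSnoc {M : Type*} [LA.Structure M] {n m : ℕ}
    (σ : ℕ ⊕ Fin n → LA.Term (ℕ ⊕ Fin m)) (v : ℕ → M) (ys : Fin m → M) (y : M) :
    (fun k => (substSnoc σ (Sum.inl k)).realize (Sum.elim v (Fin.snoc ys y : Fin (m + 1) → M))) =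
      (fun k => (σ (Sum.inl k)).realize (Sum.elim v ys)) ∧
    (fun i => (substSnoc σ (Sum.inr i)).realize (Sum.elim v (Fin.snoc ys y : Fin (m + 1) → M))) =
      (Fin.snoc (fun i => (σ (Sum.inr i)).realize (Sum.elim v ys)) y : Fin (n + 1) → M) := by
  have h : (Sum.elim v (Fin.snoc ys y : Fin (m + 1) → M)) ∘ Sum.map id Fin.castSucc =
      Sum.elim v ys := by
    funext y
    rcases y with y | y <;> simp
  constructor
  · funext k
    simp only [substSnoc, Sum.elim_inl, Term.realize_relabel, h]
  · funext i
    refine Fin.lastCases ?_ (fun i => ?_) i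
    · simp [substSnoc]
    · simp only [substSnoc, Sum.elim_inr, Fin.snoc_castSucc, Term.realize_relabel, h]

/-- At a bounded quantifier the substitution is applied to the bounding term and extended by the
identity on the new variable, so the result is again a bounded quantifier. -/
lemma IsDelta0.exists_subst {M : Type*} [LA.Structure M] {n : ℕ} {φ : LA.BoundedFormula ℕ n}
    (h : IsDelta0 φ) : ∀ {m : ℕ} (σ : ℕ ⊕ Fin n → LA.Term (ℕ ⊕ Fin m)),
    ∃ ψ : LA.BoundedFormula ℕ m, IsDelta0 ψ ∧ ∀ (v : ℕ → M) (ys : Fin m → M),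
      ψ.Realize v ys ↔ φ.Realize (fun k => (σ (Sum.inl k)).realize (Sum.elim v ys))
        (fun i => (σ (Sum.inr i)).realize (Sum.elim v ys)) := by
  have elim_eq : ∀ {n m : ℕ} (σ : ℕ ⊕ Fin n → LA.Term (ℕ ⊕ Fin m)) (v : ℕ → M) (ys : Fin m → M),
      Sum.elim (fun k => (σ (Sum.inl k)).realize (Sum.elim v ys))
        (fun i => (σ (Sum.inr i)).realize (Sum.elim v ys)) =
      fun x => (σ x).realize (Sum.elim v ys) := by
    intro n m σ v ys
    funext x
    rcases x with x | x <;> rfl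
  induction h with
  | falsum => exact fun σ => ⟨⊥, .falsum, fun _ _ => Iff.rfl⟩
  | atomic h =>
    intro m σ
    cases h with
    | equal t₁ t₂ =>
      refine ⟨(t₁.subst σ).bdEqual (t₂.subst σ), .atomic (.equal _ _), fun v ys => ?_⟩
      simp only [BoundedFormula.realize_bdEqual, Term.realize_subst, elim_eq]
    | rel R ts =>
      refine ⟨R.boundedFormula fun i => (ts i).subst σ, .atomic (.rel _ _), fun v ys => ?_⟩
      simp only [BoundedFormula.realize_rel, Term.realize_subst, elim_eq]
  | imp _ _ h₁ h₂ =>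
    intro m σ
    obtain ⟨ψ₁, hψ₁, h₁⟩ := h₁ σ
    obtain ⟨ψ₂, hψ₂, h₂⟩ := h₂ σ
    exact ⟨ψ₁.imp ψ₂, hψ₁.imp hψ₂, fun v ys => by
      rw [BoundedFormula.realize_imp, BoundedFormula.realize_imp, h₁, h₂]⟩
  | ball t _ ih =>
    intro m σ
    obtain ⟨ψ, hψ, ih⟩ := ih (substSnoc σ)
    refine ⟨_, .ball (t.subst σ) hψ, fun v ys => ?_⟩
    simp only [BoundedFormula.realize_all, BoundedFormula.realize_imp, realize_newLt, ih,
      Term.realize_subst, elim_eq, (realize_substSnoc σ v ys _).1, (realize_substSnoc σ v ys _).2]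
  | bex t _ ih =>
    intro m σ
    obtain ⟨ψ, hψ, ih⟩ := ih (substSnoc σ)
    refine ⟨_, .bex (t.subst σ) hψ, fun v ys => ?_⟩
    simp only [BoundedFormula.realize_ex, BoundedFormula.realize_inf, realize_newLt, ih,
      Term.realize_subst, elim_eq, (realize_substSnoc σ v ys _).1, (realize_substSnoc σ v ys _).2]

/-! ### Relations definable with parameters on tuples -/

section Definability

section Interleave

variable {M : Type*}

/-- Interleaving of two sequences of parameters. -/
def interleave (v w : ℕ → M) (k : ℕ) : M := if k % 2 = 0 then v (k / 2) else w (k / 2)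

lemma interleave_left (v w : ℕ → M) (k : ℕ) : interleave v w (2 * k) = v k := by
  simp [interleave]

lemma interleave_right (v w : ℕ → M) (k : ℕ) : interleave v w (2 * k + 1) = w k := by
  have h : (2 * k + 1) / 2 = k := by omega
  simp [interleave, Nat.add_mod, h]

end Interleave

/-- `Γ` is a type of finite tuples of elements of `M`. -/
class Ctx (M : outParam (Type*)) (Γ : Type*) where
  length : ℕ
  coord : Γ → Fin length → M

/-- The priority matters: as `M` is an out-parameter, this instance also matches `Γ × M`, with pairs
read as single elements, so `Ctx.prod` has to be tried first. -/
instance (priority := 100) Ctx.single {M : Type*} : Ctx M M := ⟨1, fun x => ![x]⟩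

instance Ctx.prod {M Γ : Type*} [Ctx M Γ] : Ctx M (Γ × M) :=
  ⟨Ctx.length Γ + 1, fun p => Fin.snoc (Ctx.coord p.1) p.2⟩

variable {M : Type*} [LA.Structure M] {Γ : Type*} [Ctx M Γ]

/-- `t` is given by a term with parameters from the sequence `v`. -/
def TermAt (v : ℕ → M) (t : Γ → M) : Prop :=
  ∃ τ : LA.Term (ℕ ⊕ Fin (Ctx.length Γ)), ∀ γ, τ.realize (Sum.elim v (Ctx.coord γ)) = t γ

/-- `P` is defined by a `Δ₀`-formula with parameters from the sequence `v`. -/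
def Delta0At (v : ℕ → M) (P : Γ → Prop) : Prop :=
  ∃ φ : LA.BoundedFormula ℕ (Ctx.length Γ), IsDelta0 φ ∧ ∀ γ, φ.Realize v (Ctx.coord γ) ↔ P γ

/-- `t` is given by a term with parameters. -/
def IsTermFun (t : Γ → M) : Prop := ∃ v, TermAt v t

/-- `P` is `Δ₀`-definable with parameters. -/
def Delta0 (P : Γ → Prop) : Prop := ∃ v : ℕ → M, Delta0At v P

lemma TermAt.lift {v w : ℕ → M} {g : ℕ → ℕ} (hg : ∀ k, w (g k) = v k) {t : Γ → M}
    (h : TermAt v t) : TermAt w t := by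
  obtain ⟨τ, hτ⟩ := h
  refine ⟨τ.relabel (Sum.map g id), fun γ => ?_⟩
  rw [Term.realize_relabel, ← hτ]
  congr 1
  funext x
  rcases x with x | x <;> simp [hg]

/-- Renaming parameters allows relations with different parameter sequences to be written over one
common sequence. -/
lemma Delta0At.lift {v w : ℕ → M} {g : ℕ → ℕ} (hg : ∀ k, w (g k) = v k) {P : Γ → Prop}
    (h : Delta0At v P) : Delta0At w P := by
  obtain ⟨φ, hφ, hP⟩ := h
  obtain ⟨ψ, hψ, h⟩ := hφ.exists_subst (M := M)
    (Sum.elim (fun k => Term.var (Sum.inl (g k))) fun i => Term.var (Sum.inr i))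
  refine ⟨ψ, hψ, fun γ => ?_⟩
  rw [h, ← hP]
  simp only [Sum.elim_inl, Sum.elim_inr, Term.realize_var, hg]

namespace IsTermFun

lemma const (c : M) : IsTermFun (fun _ : Γ => c) :=
  ⟨fun _ => c, Term.var (Sum.inl 0), fun _ => rfl⟩

lemma single : IsTermFun (fun x : M => x) :=
  ⟨fun _ => Structure.funMap zeroSymb ![], Term.var (Sum.inr (0 : Fin 1)), fun _ => rfl⟩

lemma snd : IsTermFun (fun p : Γ × M => p.2) :=
  ⟨fun _ => Structure.funMap zeroSymb ![], Term.var (Sum.inr (Fin.last _)), fun p => by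
    simp [Ctx.coord]⟩

lemma fst {t : Γ → M} (h : IsTermFun t) : IsTermFun (fun p : Γ × M => t p.1) := by
  obtain ⟨v, τ, hτ⟩ := h
  refine ⟨v, τ.relabel (Sum.map id Fin.castSucc), fun p => ?_⟩
  refine Eq.trans ?_ (hτ p.1)
  rw [Term.realize_relabel]
  congr 1
  funext x
  rcases x with x | x
  · rfl
  · simp [Ctx.coord]

lemma common {s t : Γ → M} (hs : IsTermFun s) (ht : IsTermFun t) :
    ∃ v, TermAt v s ∧ TermAt v t := by
  obtain ⟨v, hs⟩ := hs
  obtain ⟨w, ht⟩ := ht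
  exact ⟨interleave v w, hs.lift (interleave_left v w), ht.lift (interleave_right v w)⟩

lemma add {s t : Γ → M} (hs : IsTermFun s) (ht : IsTermFun t) :
    IsTermFun (fun γ => s γ + t γ) := by
  obtain ⟨v, ⟨σ, hσ⟩, ⟨τ, hτ⟩⟩ := common hs ht
  refine ⟨v, addSymb.apply₂ σ τ, fun γ => ?_⟩
  rw [Term.realize_functions_apply₂, hσ, hτ]
  rfl

lemma mul {s t : Γ → M} (hs : IsTermFun s) (ht : IsTermFun t) :
    IsTermFun (fun γ => s γ * t γ) := by
  obtain ⟨v, ⟨σ, hσ⟩, ⟨τ, hτ⟩⟩ := common hs ht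
  refine ⟨v, mulSymb.apply₂ σ τ, fun γ => ?_⟩
  rw [Term.realize_functions_apply₂, hσ, hτ]
  rfl

end IsTermFun

namespace Delta0

lemma common {P Q : Γ → Prop} (hP : Delta0 P) (hQ : Delta0 Q) :
    ∃ v : ℕ → M, Delta0At v P ∧ Delta0At v Q := by
  obtain ⟨v, hP⟩ := hP
  obtain ⟨w, hQ⟩ := hQ
  exact ⟨interleave v w, hP.lift (interleave_left v w), hQ.lift (interleave_right v w)⟩

lemma congr {P Q : Γ → Prop} (hP : Delta0 P) (h : ∀ γ, P γ ↔ Q γ) : Delta0 Q := by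
  rwa [show Q = P from funext fun γ => propext (h γ).symm]

lemma eq {s t : Γ → M} (hs : IsTermFun s) (ht : IsTermFun t) :
    Delta0 (fun γ => s γ = t γ) := by
  obtain ⟨v, ⟨σ, hσ⟩, ⟨τ, hτ⟩⟩ := hs.common ht
  refine ⟨v, σ.bdEqual τ, .atomic (.equal _ _), fun γ => ?_⟩
  rw [BoundedFormula.realize_bdEqual, hσ, hτ]

lemma lt {s t : Γ → M} (hs : IsTermFun s) (ht : IsTermFun t) :
    Delta0 (fun γ => s γ < t γ) := by
  obtain ⟨v, ⟨σ, hσ⟩, ⟨τ, hτ⟩⟩ := hs.common ht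
  refine ⟨v, ltFormula σ τ, .atomic (.rel _ _), fun γ => ?_⟩
  rw [ltFormula, BoundedFormula.realize_rel₂, hσ, hτ]
  rfl

lemma imp {P Q : Γ → Prop} (hP : Delta0 P) (hQ : Delta0 Q) : Delta0 (fun γ => P γ → Q γ) := by
  obtain ⟨v, ⟨φ, hφ, hP⟩, ⟨ψ, hψ, hQ⟩⟩ := common hP hQ
  exact ⟨v, φ.imp ψ, hφ.imp hψ, fun γ => by rw [BoundedFormula.realize_imp, hP, hQ]⟩

lemma false : Delta0 (fun _ : Γ => False) :=
  ⟨fun _ => Structure.funMap zeroSymb ![], ⊥, .falsum, fun _ => Iff.rfl⟩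

lemma not {P : Γ → Prop} (hP : Delta0 P) : Delta0 (fun γ => ¬ P γ) := hP.imp false

lemma or {P Q : Γ → Prop} (hP : Delta0 P) (hQ : Delta0 Q) : Delta0 (fun γ => P γ ∨ Q γ) :=
  (hP.not.imp hQ).congr fun _ => or_iff_not_imp_left.symm

lemma and {P Q : Γ → Prop} (hP : Delta0 P) (hQ : Delta0 Q) : Delta0 (fun γ => P γ ∧ Q γ) :=
  (hP.imp hQ.not).not.congr fun γ => by tauto

lemma ball {t : Γ → M} (ht : IsTermFun t) {P : Γ → M → Prop}
    (hP : Delta0 (fun p : Γ × M => P p.1 p.2)) : Delta0 (fun γ => ∀ x, x < t γ → P γ x) := by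
  obtain ⟨v, ht⟩ := ht
  obtain ⟨w, hP⟩ := hP
  obtain ⟨τ, hτ⟩ := ht.lift (interleave_left v w)
  obtain ⟨φ, hφ, hP⟩ := hP.lift (interleave_right v w)
  refine ⟨interleave v w, ((newLt τ).imp φ).all, .ball τ hφ, fun γ => ?_⟩
  rw [BoundedFormula.realize_all]
  refine forall_congr' fun x => ?_
  rw [BoundedFormula.realize_imp, realize_newLt, hτ]
  exact imp_congr Iff.rfl (hP (γ, x))

lemma bex {t : Γ → M} (ht : IsTermFun t) {P : Γ → M → Prop}
    (hP : Delta0 (fun p : Γ × M => P p.1 p.2)) : Delta0 (fun γ => ∃ x, x < t γ ∧ P γ x) :=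
  (ball ht (P := fun γ x => ¬ P γ x) hP.not).not.congr fun γ => by simp

end Delta0

/-- `r` replaces each variable by a term. -/
def IsSubst {Γ' : Type*} [Ctx M Γ'] (r : Γ' → Γ) : Prop :=
  ∀ i, IsTermFun (fun γ => Ctx.coord (r γ) i)

namespace IsSubst

variable {Γ' : Type*} [Ctx M Γ']

lemma single {t : Γ' → M} (ht : IsTermFun t) : IsSubst (Γ := M) t := by
  intro i
  obtain rfl : i = (0 : Fin 1) := Subsingleton.elim (α := Fin 1) _ _
  exact ht

lemma prod {r : Γ' → Γ} {t : Γ' → M} (hr : IsSubst r) (ht : IsTermFun t) :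
    IsSubst (fun γ => (r γ, t γ)) := by
  refine Fin.lastCases ?_ fun i => ?_
  · simpa [Ctx.coord] using ht
  · simpa [Ctx.coord] using hr i

lemma fst {r : Γ' → Γ} (hr : IsSubst r) : IsSubst (fun p : Γ' × M => r p.1) :=
  fun i => (hr i).fst

lemma coord (i : Fin (Ctx.length Γ)) : IsTermFun (fun γ : Γ => Ctx.coord γ i) :=
  ⟨fun _ => Structure.funMap zeroSymb ![], Term.var (Sum.inr i), fun _ => rfl⟩

lemma id : IsSubst (fun γ : Γ => γ) := coord

end IsSubst

lemma Delta0.comp {Γ' : Type*} [Ctx M Γ'] {P : Γ → Prop} (hP : Delta0 P) {r : Γ' → Γ}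
    (hr : IsSubst r) : Delta0 (fun γ => P (r γ)) := by
  obtain ⟨v, φ, hφ, hP⟩ := hP
  choose w hw using hr
  -- All parameters are packed into one sequence by the pairing function: row `i` holds those of the
  -- `i`-th substituted term, row `Ctx.length Γ` those of `P`.
  let u : ℕ → M := fun k => if h : (Nat.unpair k).1 < Ctx.length Γ then
    w ⟨_, h⟩ (Nat.unpair k).2 else v (Nat.unpair k).2
  have hu₁ : ∀ i k, u (Nat.pair (i : Fin (Ctx.length Γ)) k) = w i k := by simp [u]
  have hu₂ : ∀ k, u (Nat.pair (Ctx.length Γ) k) = v k := by simp [u]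
  choose τ hτ using fun i => (hw i).lift (hu₁ i)
  obtain ⟨ψ, hψ, h⟩ := hφ.exists_subst (M := M)
    (Sum.elim (fun k => Term.var (Sum.inl (Nat.pair (Ctx.length Γ) k))) τ)
  refine ⟨u, ψ, hψ, fun γ => ?_⟩
  refine (h _ _).trans (Iff.trans ?_ (hP (r γ)))
  simp only [Sum.elim_inl, Sum.elim_inr, Term.realize_var, hu₂, hτ]

lemma Delta0.comp_pair {Γ' : Type*} [Ctx M Γ'] {P : Γ → M → Prop}
    (hP : Delta0 (fun p : Γ × M => P p.1 p.2)) {r : Γ' → Γ} {t : Γ' → M} (hr : IsSubst r)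
    (ht : IsTermFun t) : Delta0 (fun γ => P (r γ) (t γ)) := hP.comp (hr.prod ht)

/-- `P` is `Σ₁`-definable with parameters. -/
def Sigma1 (P : Γ → Prop) : Prop :=
  ∃ Q : Γ → M → Prop, Delta0 (fun p : Γ × M => Q p.1 p.2) ∧ ∀ γ, P γ ↔ ∃ x, Q γ x

namespace Sigma1

lemma congr {P Q : Γ → Prop} (hP : Sigma1 P) (h : ∀ γ, P γ ↔ Q γ) : Sigma1 Q := by
  rwa [show Q = P from funext fun γ => propext (h γ).symm]

lemma comp {Γ' : Type*} [Ctx M Γ'] {P : Γ → Prop} (hP : Sigma1 P) {r : Γ' → Γ}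
    (hr : IsSubst r) : Sigma1 (fun γ => P (r γ)) := by
  obtain ⟨Q, hQ, h⟩ := hP
  exact ⟨fun γ x => Q (r γ) x, hQ.comp (hr.fst.prod .snd), fun γ => h (r γ)⟩

lemma exists_formula {P : M → Prop} (h : Sigma1 P) :
    ∃ (v : ℕ → M) (φ : LA.BoundedFormula ℕ 1), IsSigma1 φ ∧ ∀ x, φ.Realize v ![x] ↔ P x := by
  obtain ⟨Q, ⟨v, φ, hφ, hQ⟩, h⟩ := h
  refine ⟨v, BoundedFormula.ex φ, .ex (.delta0 hφ), fun x => ?_⟩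
  rw [BoundedFormula.realize_ex, h]
  exact exists_congr fun y => hQ (x, y)

end Sigma1

end Definability

/-! ### Closure properties, collection and the least number principle -/

section SigmaOne

variable {M : Type*} [LA.Structure M] [hM : Fact (ModelsISigma1 M)] {Γ : Type*} [Ctx M Γ]

/-- Induction for `Σ₁`-definable properties. -/
theorem Sigma1.induction {P : M → Prop} (hP : Sigma1 P) (zero : P 0)
    (succ : ∀ x, P x → P (x + 1)) (x : M) : P x := by
  obtain ⟨v, φ, hφ, h⟩ := hP.exists_formula
  rw [← h]
  refine hM.out.induction φ hφ v ((h _).2 zero) (fun x hx => ?_) x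
  rw [h] at hx ⊢
  exact succ x hx

lemma Delta0.le {s t : Γ → M} (hs : IsTermFun s) (ht : IsTermFun t) :
    Delta0 (fun γ => s γ ≤ t γ) :=
  ((Delta0.lt hs ht).or (.eq hs ht)).congr fun _ => le_iff_lt_or_eq.symm

lemma Delta0.sigma1 {P : Γ → Prop} (hP : Delta0 P) : Sigma1 P :=
  ⟨fun γ _ => P γ, hP.comp IsSubst.id.fst, fun _ => ⟨fun h => ⟨0, h⟩, fun ⟨_, h⟩ => h⟩⟩

namespace Sigma1

lemma exists_delta0 {P : Γ → M → Prop} (hP : Delta0 (fun p : Γ × M => P p.1 p.2)) :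
    Sigma1 (fun γ => ∃ x, P γ x) := ⟨P, hP, fun _ => Iff.rfl⟩

/-- Two unbounded quantifiers merge into one: a single `z` bounds both witnesses, and below `z` the
quantifiers are bounded. -/
protected lemma ex {P : Γ → M → Prop} (hP : Sigma1 (fun p : Γ × M => P p.1 p.2)) :
    Sigma1 (fun γ => ∃ x, P γ x) := by
  obtain ⟨Q, hQ, h⟩ := hP
  refine ⟨fun γ z => ∃ x, x < z ∧ ∃ y, y < z ∧ Q (γ, x) y, ?_, fun γ => ?_⟩
  · refine .bex .snd (.bex (IsTermFun.snd.fst) (hQ.comp_pair ?_ .snd))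
    exact IsSubst.id.fst.fst.fst.prod IsTermFun.snd.fst
  · constructor
    · rintro ⟨x, hx⟩
      obtain ⟨y, hy⟩ := (h (γ, x)).1 hx
      refine ⟨x + y + 1, x, lt_succ_iff.2 le_self_add, y, lt_succ_iff.2 le_add_self, hy⟩
    · rintro ⟨z, x, -, y, -, hy⟩
      exact ⟨x, (h (γ, x)).2 ⟨y, hy⟩⟩

lemma and {P Q : Γ → Prop} (hP : Sigma1 P) (hQ : Sigma1 Q) : Sigma1 (fun γ => P γ ∧ Q γ) := by
  obtain ⟨P', hP', hP⟩ := hP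
  obtain ⟨Q', hQ', hQ⟩ := hQ
  have := (exists_delta0 (P := fun (p : Γ × M) x => P' p.1 p.2 ∧ Q' p.1 x)
    ((hP'.comp IsSubst.id.fst).and (hQ'.comp (IsSubst.id.fst.fst.prod .snd)))).ex
      (P := fun γ x => ∃ y, P' γ x ∧ Q' γ y)
  exact this.congr fun γ => by simp [hP, hQ]

lemma or {P Q : Γ → Prop} (hP : Sigma1 P) (hQ : Sigma1 Q) : Sigma1 (fun γ => P γ ∨ Q γ) := by
  obtain ⟨P', hP', hP⟩ := hP
  obtain ⟨Q', hQ', hQ⟩ := hQ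
  exact (exists_delta0 (P := fun γ x => P' γ x ∨ Q' γ x) (hP'.or hQ')).congr fun γ => by
    simp [hP, hQ, exists_or]

lemma bex {t : Γ → M} (ht : IsTermFun t) {P : Γ → M → Prop}
    (hP : Sigma1 (fun p : Γ × M => P p.1 p.2)) : Sigma1 (fun γ => ∃ x, x < t γ ∧ P γ x) :=
  Sigma1.ex ((Delta0.lt .snd ht.fst).sigma1.and hP)

/-- `Σ₁`-collection, for a `Δ₀`-relation. -/
lemma collection {Q : M → M → Prop} (hQ : Delta0 (fun p : M × M => Q p.1 p.2)) (u : M)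
    (h : ∀ x, x < u → ∃ y, Q x y) : ∃ b, ∀ x, x < u → ∃ y, y < b ∧ Q x y := by
  -- Induction runs over all of `M`, so the restriction `j ≤ u` is built into the formula as a
  -- disjunct. The same device recurs in later inductions.
  have key : ∀ j, u < j ∨ ∃ b, ∀ x, x < j → ∃ y, y < b ∧ Q x y := by
    refine Sigma1.induction ?_ (Or.inr ⟨0, fun x hx => absurd hx not_lt_zero⟩) fun j hj => ?_
    · refine (Delta0.lt (.const u) .single).sigma1.or (exists_delta0 ?_)
      refine .ball IsTermFun.single.fst (.bex (IsTermFun.snd.fst) (hQ.comp_pair ?_ .snd))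
      exact .single IsTermFun.snd.fst
    · rcases hj with hj | ⟨b, hb⟩
      · exact Or.inl (hj.trans (lt_succ_iff.2 le_rfl))
      rcases lt_or_ge j u with hju | hju
      · obtain ⟨y, hy⟩ := h j hju
        refine Or.inr ⟨b + y + 1, fun x hx => ?_⟩
        rcases (lt_succ_iff.1 hx).lt_or_eq with hx | rfl
        · obtain ⟨z, hz, hQ⟩ := hb x hx
          exact ⟨z, lt_succ_iff.2 (hz.le.trans le_self_add), hQ⟩
        · exact ⟨y, lt_succ_iff.2 le_add_self, hy⟩
      · exact Or.inl (lt_succ_iff.2 hju)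
  exact (key u).resolve_left (lt_irrefl u)

/-- Collection bounds the witnesses uniformly, which moves the unbounded quantifier in front of the
bounded one. -/
lemma ball {t : Γ → M} (ht : IsTermFun t) {P : Γ → M → Prop}
    (hP : Sigma1 (fun p : Γ × M => P p.1 p.2)) : Sigma1 (fun γ => ∀ x, x < t γ → P γ x) := by
  obtain ⟨Q, hQ, h⟩ := hP
  refine ⟨fun γ b => ∀ x, x < t γ → ∃ y, y < b ∧ Q (γ, x) y, ?_, fun γ => ⟨fun hγ => ?_, ?_⟩⟩
  · refine .ball ht.fst (.bex IsTermFun.snd.fst (hQ.comp_pair ?_ .snd))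
    exact IsSubst.id.fst.fst.fst.prod IsTermFun.snd.fst
  · refine collection (Q := fun x y => Q (γ, x) y) (hQ.comp_pair ?_ .snd) (t γ)
      fun x hx => (h (γ, x)).1 (hγ x hx)
    exact IsSubst.prod (fun i => .const _) IsTermFun.single.fst
  · rintro ⟨b, hb⟩ x hx
    obtain ⟨y, -, hy⟩ := hb x hx
    exact (h (γ, x)).2 ⟨y, hy⟩

lemma imp {P Q : Γ → Prop} (hP : Sigma1 (fun γ => ¬ P γ)) (hQ : Sigma1 Q) :
    Sigma1 (fun γ => P γ → Q γ) :=
  (hP.or hQ).congr fun _ => imp_iff_not_or.symm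

end Sigma1

/-- `P` is `Δ₁`-definable with parameters. -/
structure Delta1 (P : Γ → Prop) : Prop where
  sigma : Sigma1 P
  pi : Sigma1 (fun γ => ¬ P γ)

lemma Delta0.delta1 {P : Γ → Prop} (hP : Delta0 P) : Delta1 P := ⟨hP.sigma1, hP.not.sigma1⟩

namespace Delta1

lemma congr {P Q : Γ → Prop} (hP : Delta1 P) (h : ∀ γ, P γ ↔ Q γ) : Delta1 Q := by
  rwa [show Q = P from funext fun γ => propext (h γ).symm]

lemma comp {Γ' : Type*} [Ctx M Γ'] {P : Γ → Prop} (hP : Delta1 P) {r : Γ' → Γ}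
    (hr : IsSubst r) : Delta1 (fun γ => P (r γ)) := ⟨hP.sigma.comp hr, hP.pi.comp hr⟩

lemma not {P : Γ → Prop} (hP : Delta1 P) : Delta1 (fun γ => ¬ P γ) :=
  ⟨hP.pi, hP.sigma.congr fun _ => not_not.symm⟩

lemma and {P Q : Γ → Prop} (hP : Delta1 P) (hQ : Delta1 Q) : Delta1 (fun γ => P γ ∧ Q γ) :=
  ⟨hP.sigma.and hQ.sigma, (hP.pi.or hQ.pi).congr fun _ => not_and_or.symm⟩

lemma or {P Q : Γ → Prop} (hP : Delta1 P) (hQ : Delta1 Q) : Delta1 (fun γ => P γ ∨ Q γ) :=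
  ⟨hP.sigma.or hQ.sigma, (hP.pi.and hQ.pi).congr fun _ => not_or.symm⟩

lemma imp {P Q : Γ → Prop} (hP : Delta1 P) (hQ : Delta1 Q) : Delta1 (fun γ => P γ → Q γ) :=
  (hP.not.or hQ).congr fun _ => imp_iff_not_or.symm

lemma iff {P Q : Γ → Prop} (hP : Delta1 P) (hQ : Delta1 Q) : Delta1 (fun γ => P γ ↔ Q γ) :=
  ((hP.imp hQ).and (hQ.imp hP)).congr fun _ => iff_iff_implies_and_implies.symm

lemma ball {t : Γ → M} (ht : IsTermFun t) {P : Γ → M → Prop}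
    (hP : Delta1 (fun p : Γ × M => P p.1 p.2)) : Delta1 (fun γ => ∀ x, x < t γ → P γ x) :=
  ⟨.ball ht hP.sigma, (Sigma1.bex ht (P := fun γ x => ¬ P γ x) hP.pi).congr fun _ => by simp⟩

lemma bex {t : Γ → M} (ht : IsTermFun t) {P : Γ → M → Prop}
    (hP : Delta1 (fun p : Γ × M => P p.1 p.2)) : Delta1 (fun γ => ∃ x, x < t γ ∧ P γ x) :=
  ⟨.bex ht hP.sigma, (Sigma1.ball ht (P := fun γ x => ¬ P γ x) hP.pi).congr fun _ => by simp⟩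

/-- The least number principle for `Δ₁`-definable properties. -/
lemma exists_least {P : M → Prop} (hP : Delta1 P) {x : M} (hx : P x) :
    ∃ y, P y ∧ ∀ z, z < y → ¬ P z := by
  by_contra! h
  have key : ∀ y z, z < y → ¬ P z := by
    refine Sigma1.induction (.ball .single ?_) (fun z hz => absurd hz not_lt_zero) ?_
    · exact hP.pi.comp (.single .snd)
    · intro y hy z hz
      rcases (lt_succ_iff.1 hz).lt_or_eq with hz | rfl
      · exact hy z hz
      · intro hz
        obtain ⟨w, hw, hPw⟩ := h z hz
        exact hy w hw hPw
  exact key (x + 1) x (lt_succ_iff.2 le_rfl) hx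

end Delta1

end SigmaOne

/-! ### Division and the `β`-function -/

section Beta

variable {M : Type*} [LA.Structure M] [hM : Fact (ModelsISigma1 M)] {Γ : Type*} [Ctx M Γ]

lemma IsTermFun.var₁ : IsTermFun (fun p : (Γ × M) × M => p.1.2) := IsTermFun.snd.fst

lemma IsTermFun.var₂ : IsTermFun (fun p : ((Γ × M) × M) × M => p.1.1.2) := IsTermFun.snd.fst.fst

lemma IsTermFun.var₃ : IsTermFun (fun p : (((Γ × M) × M) × M) × M => p.1.1.1.2) :=
  IsTermFun.snd.fst.fst.fst

lemma Sigma1.comp₂ {P : M → M → Prop} (hP : Sigma1 (fun p : M × M => P p.1 p.2)) {s t : Γ → M}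
    (hs : IsTermFun s) (ht : IsTermFun t) : Sigma1 (fun γ => P (s γ) (t γ)) :=
  hP.comp ((IsSubst.single hs).prod ht)

lemma Delta1.comp₂ {P : M → M → Prop} (hP : Delta1 (fun p : M × M => P p.1 p.2)) {s t : Γ → M}
    (hs : IsTermFun s) (ht : IsTermFun t) : Delta1 (fun γ => P (s γ) (t γ)) :=
  ⟨hP.sigma.comp₂ hs ht, hP.pi.comp₂ (P := fun x y => ¬ P x y) hs ht⟩

lemma Delta1.comp₃ {P : M → M → M → Prop} (hP : Delta1 (fun p : (M × M) × M => P p.1.1 p.1.2 p.2))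
    {s t u : Γ → M} (hs : IsTermFun s) (ht : IsTermFun t) (hu : IsTermFun u) :
    Delta1 (fun γ => P (s γ) (t γ) (u γ)) :=
  hP.comp (((IsSubst.single hs).prod ht).prod hu)

/-! ### Division with remainder -/

lemma exists_div {m : M} (hm : 0 < m) (a : M) : ∃ q r, a = q * m + r ∧ r < m := by
  revert a
  refine Sigma1.induction ?_ ⟨0, 0, by simp, hm⟩ ?_
  · refine .ex (.ex (Delta0.sigma1 (.and (.eq ?_ ?_) (.lt .snd (.const m)))))
    · exact IsTermFun.single.fst.fst
    · exact (IsTermFun.var₁.mul (.const m)).add .snd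
  · rintro a ⟨q, r, rfl, hr⟩
    rcases (succ_le_iff.2 hr).lt_or_eq with h | h
    · exact ⟨q, r + 1, by ring, h⟩
    · exact ⟨q + 1, 0, by rw [add_assoc, h]; ring, hm⟩

lemma div_unique {m q r q' r' : M} (hr : r < m) (hr' : r' < m) (h : q * m + r = q' * m + r') :
    q = q' ∧ r = r' := by
  have key : ∀ {q r q' r' : M}, r' < m → q * m + r = q' * m + r' → ¬ q' < q := by
    intro q r q' r' hr' h hq
    obtain ⟨e, rfl⟩ := exists_add_of_le (succ_le_iff.2 hq)
    have h' : q' * m + (m + (e * m + r)) = q' * m + r' := by rw [← h]; ring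
    have := add_left_cancel h'
    exact absurd hr' (not_lt.2 (this ▸ le_self_add))
  have hq : q = q' := le_antisymm (not_lt.1 (key hr' h)) (not_lt.1 (key hr h.symm))
  subst hq
  exact ⟨rfl, add_left_cancel h⟩

/-! ### Gödel's `β`-function -/

/-- The bound on the quotient is automatic because the modulus is at least `1`. -/
lemma beta_iff {c d i z : M} :
    Beta c d i z ↔ z < (i + 1) * d + 1 ∧ ∃ q, c = q * ((i + 1) * d + 1) + z := by
  rw [Beta, add_comm (1 : M)]
  refine and_congr_right fun hz => ⟨fun ⟨q, _, h⟩ => ⟨q, h⟩, fun ⟨q, h⟩ => ⟨q, ?_, h⟩⟩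
  rw [lt_succ_iff, h]
  calc q = q * 1 := (mul_one q).symm
    _ ≤ q * ((i + 1) * d + 1) := mul_le_mul_right (le_add_self) q
    _ ≤ _ := le_self_add

lemma Beta.unique {c d i z z' : M} (h : Beta c d i z) (h' : Beta c d i z') : z = z' := by
  obtain ⟨hz, q, hq⟩ := beta_iff.1 h
  obtain ⟨hz', q', hq'⟩ := beta_iff.1 h'
  exact (div_unique hz hz' (hq.symm.trans hq')).2

lemma Beta.le {c d i z : M} (h : Beta c d i z) : z ≤ c := by
  obtain ⟨-, q, -, h⟩ := h
  exact h ▸ le_add_self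

lemma Delta0.beta {c d i z : Γ → M} (hc : IsTermFun c) (hd : IsTermFun d) (hi : IsTermFun i)
    (hz : IsTermFun z) : Delta0 (fun γ => Beta (c γ) (d γ) (i γ) (z γ)) :=
  have hm := (IsTermFun.const (Γ := Γ) (1 : M)).add ((hi.add (.const 1)).mul hd)
  .and (.lt hz hm) (.bex (hc.add (.const 1)) (.eq hc.fst ((IsTermFun.snd.mul hm.fst).add hz.fst)))

/-- `a` is invertible modulo `m`. -/
def UnitMod (m a : M) : Prop := ∃ u w, u * a = w * m + 1

lemma UnitMod.mul {m a b : M} (ha : UnitMod m a) (hb : UnitMod m b) : UnitMod m (a * b) := by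
  obtain ⟨u, w, h⟩ := ha
  obtain ⟨v, t, h'⟩ := hb
  refine ⟨u * v, w * t * m + w + t, ?_⟩
  calc u * v * (a * b) = (u * a) * (v * b) := by ring
    _ = _ := by rw [h, h']; ring

lemma UnitMod.of_mul {m a b : M} (h : UnitMod m (a * b)) : UnitMod m a := by
  obtain ⟨u, w, h⟩ := h
  exact ⟨u * b, w, by rw [← h]; ring⟩

/-- Two moduli of the `β`-function differ by `(δ + 1) d`. This is a unit modulo the larger one `m`,
because `d` is a unit and `δ + 1` divides `d`; hence so is the smaller modulus, which is congruent
to minus the difference. There is no subtraction, so inverses are obtained by squaring elements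
congruent to `-1`. -/
lemma unitMod_modulus {d j δ : M} (hd : 0 < d) (hδ : ∃ q, d = q * (δ + 1)) :
    UnitMod ((j + (δ + 1) + 1) * d + 1) ((j + 1) * d + 1) := by
  set m := (j + (δ + 1) + 1) * d + 1 with hm
  set m' := (j + 1) * d + 1 with hm'
  have h₁ : m = m' + (δ + 1) * d := by rw [hm, hm']; ring
  -- `d` is a unit, since `(k + 1) d = -1` modulo `m`, where `k = j + δ + 1`
  have hdu : UnitMod m d := by
    obtain ⟨s, hs⟩ : ∃ s, (j + (δ + 1) + 1) * d = s + 1 :=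
      exists_eq_succ (mul_pos (lt_succ_iff.2 zero_le) hd)
    -- With `m = s + 2` this is `(s + 1)² = s (s + 2) + 1`.
    refine ⟨(j + (δ + 1) + 1) * ((j + (δ + 1) + 1) * d), s, ?_⟩
    calc _ = ((j + (δ + 1) + 1) * d) * ((j + (δ + 1) + 1) * d) := by ring
      _ = s * m + 1 := by rw [hm, hs]; ring
  have hδu : UnitMod m ((δ + 1) * d) := by
    obtain ⟨q, hq⟩ := hδ
    refine UnitMod.mul (UnitMod.of_mul (b := q) ?_) hdu
    rwa [mul_comm, ← hq]
  obtain ⟨u, w, hu⟩ := hδu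
  have hum : u * m' + (w * m + 1) = u * m := by rw [← hu, h₁]; ring
  have hwu : w < u := by
    by_contra! h
    have : u * m ≤ w * m := mul_le_mul_left h m
    rw [← hum] at this
    have h2 : w * m < u * m' + (w * m + 1) := by
      calc w * m < w * m + 1 := lt_succ_iff.2 le_rfl
        _ ≤ _ := le_add_self
    exact absurd this h2.not_ge
  obtain ⟨g, rfl⟩ := exists_add_of_le hwu.le
  -- With `u = w + g`, cancelling `w * m` in `hum` shows that `u * m'` is `-1` modulo `m`; squaring
  -- it then gives the inverse `u * (u * m')` of `m'`.
  have hg : (w + g) * m' + 1 = g * m := by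
    have : w * m + ((w + g) * m' + 1) = w * m + g * m := by rw [← add_mul, ← hum]; ring
    exact add_left_cancel this
  obtain ⟨s, hs⟩ : ∃ s, (w + g) * m' = s + 1 :=
    exists_eq_succ (mul_pos (lt_of_le_of_lt zero_le hwu) (lt_succ_iff.2 zero_le))
  refine ⟨(w + g) * ((w + g) * m'), s * g, ?_⟩
  calc _ = ((w + g) * m') * ((w + g) * m') := by ring
    _ = s * ((w + g) * m' + 1) + 1 := by rw [hs]; ring
    _ = _ := by rw [hg]; ring

/-- A substitute for the factorial. Divisibility makes the `β`-moduli of indices below `x` pairwise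
coprime, and `b ≤ d` makes them exceed all values to be coded. -/
lemma exists_common_multiple (x b : M) :
    ∃ d, 0 < d ∧ b ≤ d ∧ ∀ δ, δ < x → ∃ q, d = q * (δ + 1) := by
  revert x
  refine Sigma1.induction ?_ ⟨b + 1, lt_succ_iff.2 zero_le, le_self_add, fun δ h =>
    absurd h not_lt_zero⟩ ?_
  · refine .ex (.and (Delta0.lt (.const 0) .snd).sigma1 (.and (Delta0.le (.const b) .snd).sigma1
      (.ball IsTermFun.single.fst (.ex (Delta0.eq .var₂ ?_).sigma1))))
    exact IsTermFun.snd.mul (IsTermFun.var₁.add (.const 1))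
  · rintro x ⟨d, hd, hb, h⟩
    refine ⟨d * (x + 1), mul_pos hd (lt_succ_iff.2 zero_le), ?_, fun δ hδ => ?_⟩
    · calc b ≤ d * 1 := by rwa [mul_one]
        _ ≤ d * (x + 1) := mul_le_mul_right le_add_self d
    · rcases (lt_succ_iff.1 hδ).lt_or_eq with hδ | rfl
      · obtain ⟨q, hq⟩ := h δ hδ
        exact ⟨q * (x + 1), by rw [hq]; ring⟩
      · exact ⟨d, rfl⟩

/-- Choice functions for `Σ₁`-relations on initial segments are coded by the `β`-function. -/
theorem exists_beta {R : M → M → Prop} (hR : Sigma1 (fun p : M × M => R p.1 p.2)) (x b : M)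
    (h : ∀ i, i < x → ∃ z, z < b ∧ R i z) : ∃ c d, ∀ i, i < x → ∃ z, Beta c d i z ∧ R i z := by
  obtain ⟨d, hd, hbd, hdvd⟩ := exists_common_multiple x b
  -- Chinese remaindering one index at a time: `P` is a common multiple of the first `j` moduli,
  -- still invertible modulo the later ones, and `c` has suitable remainders so far.
  have key : ∀ j, x < j ∨ ∃ c P, (∀ i, i < j → ∃ q, P = q * ((i + 1) * d + 1)) ∧
      (∀ k, k < x → j ≤ k → UnitMod ((k + 1) * d + 1) P) ∧
      ∀ i, i < j → ∃ z, Beta c d i z ∧ R i z := by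
    refine Sigma1.induction ?_ (Or.inr ⟨0, 1, fun i hi => absurd hi not_lt_zero,
      fun k _ _ => ⟨1, 0, by ring⟩, fun i hi => absurd hi not_lt_zero⟩) ?_
    · refine (Delta0.lt (.const x) .single).sigma1.or (.ex (.ex (.and ?_ (.and ?_ ?_))))
      · refine .ball IsTermFun.single.fst.fst (.ex (Delta0.eq .var₂ ?_).sigma1)
        exact IsTermFun.snd.mul
          (((IsTermFun.var₁.add (.const 1)).mul (.const d)).add (.const 1))
      · refine .ball (.const x) (.imp (Delta0.le IsTermFun.single.fst.fst.fst .snd).not.sigma1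
          (.ex (.ex (Delta0.eq (IsTermFun.var₁.mul .var₃) ?_).sigma1)))
        exact (IsTermFun.snd.mul
          (((IsTermFun.var₂.add (.const 1)).mul (.const d)).add (.const 1))).add (.const 1)
      · exact .ball IsTermFun.single.fst.fst (.ex (.and
          (Delta0.beta .var₃ (.const d) .var₁ .snd).sigma1 (hR.comp₂ .var₁ .snd)))
    · rintro j (hj | ⟨c, P, hP, hU, hc⟩)
      · exact Or.inl (hj.trans (lt_succ_iff.2 le_rfl))
      rcases lt_or_ge j x with hjx | hjx
      swap
      · exact Or.inl (lt_succ_iff.2 hjx)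
      obtain ⟨u, w, huw⟩ := hU j hjx le_rfl
      obtain ⟨z, hzb, hz⟩ := h j hjx
      set t := (j + 1) * d with ht
      -- Adding a multiple of `P` keeps the earlier remainders. Modulo the new modulus `t + 1` one
      -- has `u P = 1`, so the new number is `c + z + c t = z + c (t + 1)`, that is, `z`.
      refine Or.inr ⟨c + P * (u * (z + c * t)), P * (t + 1), fun i hi => ?_, fun k hk hjk => ?_,
        fun i hi => ?_⟩
      · rcases (lt_succ_iff.1 hi).lt_or_eq with hi | rfl
        · obtain ⟨q, hq⟩ := hP i hi
          exact ⟨q * (t + 1), by rw [hq]; ring⟩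
        · exact ⟨P, rfl⟩
      · obtain ⟨δ, rfl⟩ := exists_add_of_le hjk
        refine (hU _ hk (le_self_add.trans hjk)).mul ?_
        have := unitMod_modulus (j := j) hd (hdvd δ ?_)
        · rwa [show j + (δ + 1) + 1 = j + 1 + δ + 1 by ring] at this
        · refine lt_of_le_of_lt ?_ hk
          exact le_add_self
      · rcases (lt_succ_iff.1 hi).lt_or_eq with hi | rfl
        · obtain ⟨z', hz', hR'⟩ := hc i hi
          obtain ⟨p, hp⟩ := hP i hi
          obtain ⟨hz'm, q, hq⟩ := beta_iff.1 hz'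
          refine ⟨z', beta_iff.2 ⟨hz'm, q + p * (u * (z + c * t)), ?_⟩, hR'⟩
          generalize (i + 1) * d + 1 = m at *
          generalize u * (z + c * t) = k
          rw [hp, hq]; ring
        · refine ⟨z, beta_iff.2 ⟨?_, w * (z + c * t) + c, ?_⟩, hz⟩
          · rw [lt_succ_iff]
            calc z ≤ 1 * d := by rw [one_mul]; exact hzb.le.trans hbd
              _ ≤ (i + 1) * d := mul_le_mul_left le_add_self d
          · rw [← ht]
            calc c + P * (u * (z + c * t)) = c + (u * P) * (z + c * t) := by ring
              _ = _ := by rw [huw]; ring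
  obtain h | ⟨c, P, -, -, hc⟩ := key x
  · exact absurd h (lt_irrefl x)
  · exact ⟨c, d, hc⟩

end Beta

section Exp

variable {M : Type*} [LA.Structure M] [hM : Fact (ModelsISigma1 M)] {Γ : Type*} [Ctx M Γ]

/-! ### Powers of two -/

lemma PowTwo.sigma1 : Sigma1 (fun p : M × M => PowTwo p.1 p.2) := by
  have x := (IsTermFun.single (M := M)).fst (Γ := M)
  have y := IsTermFun.snd (M := M) (Γ := M)
  refine .ex (.ex (Delta0.sigma1 ?_))
  refine .and (.beta .var₁ .snd (.const 0) (.const 1)) (.and ?_ (.beta .var₁ .snd x.fst.fst y.fst.fst))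
  refine .ball x.fst.fst (.bex (IsTermFun.var₂.add (.const 1)) (.and (.beta .var₃ .var₂ .var₁ .snd) ?_))
  exact .beta .var₃ .var₂ (IsTermFun.var₁.add (.const 1)) (IsTermFun.snd.add .snd)

lemma beta_zero_one : Beta (1 : M) 1 0 1 :=
  beta_iff.2 ⟨by rw [zero_add, mul_one]; exact lt_succ_iff.2 le_rfl, 0, by ring⟩

lemma powTwo_zero : PowTwo (0 : M) 1 :=
  ⟨1, 1, beta_zero_one, fun _ h => absurd h not_lt_zero, beta_zero_one⟩

/-- Any two `β`-coded doubling sequences which start at `1` agree. -/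
lemma PowTwo.agree {x c d c' d' : M} (h₀ : Beta c d 0 1)
    (hs : ∀ i : M, i < x → ∃ z : M, z < c + 1 ∧ Beta c d i z ∧ Beta c d (i + 1) (z + z))
    (h₀' : Beta c' d' 0 1)
    (hs' : ∀ i : M, i < x → ∃ z : M, z < c' + 1 ∧ Beta c' d' i z ∧ Beta c' d' (i + 1) (z + z)) :
    ∀ j, j ≤ x → ∃ z, Beta c d j z ∧ Beta c' d' j z := by
  have key : ∀ j, x < j ∨ ∃ z, Beta c d j z ∧ Beta c' d' j z := by
    refine Sigma1.induction ?_ (Or.inr ⟨1, h₀, h₀'⟩) ?_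
    · refine .or (Delta0.lt (.const x) .single).sigma1 (.ex (Delta0.sigma1 (.and ?_ ?_)))
      · exact .beta (.const c) (.const d) IsTermFun.single.fst .snd
      · exact .beta (.const c') (.const d') IsTermFun.single.fst .snd
    · rintro j (hj | ⟨z, hz, hz'⟩)
      · exact Or.inl (hj.trans (lt_succ_iff.2 le_rfl))
      rcases lt_or_ge j x with hjx | hjx
      · obtain ⟨w, -, hw, hw₁⟩ := hs j hjx
        obtain ⟨w', -, hw', hw₁'⟩ := hs' j hjx
        obtain rfl := hw.unique hz
        obtain rfl := hw'.unique hz'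
        exact Or.inr ⟨_, hw₁, hw₁'⟩
      · exact Or.inl (lt_succ_iff.2 hjx)
  exact fun j hj => (key j).resolve_left (not_lt.2 hj)

lemma PowTwo.unique {x y y' : M} (h : PowTwo x y) (h' : PowTwo x y') : y = y' := by
  obtain ⟨c, d, h₀, hs, hx⟩ := h
  obtain ⟨c', d', h₀', hs', hx'⟩ := h'
  obtain ⟨z, hz, hz'⟩ := PowTwo.agree h₀ hs h₀' hs' x le_rfl
  rw [hx.unique hz, hx'.unique hz']

/-- A `β`-code cannot be lengthened directly; `exists_beta` recodes the old sequence with `2 y`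
appended. -/
lemma PowTwo.succ {x y : M} (h : PowTwo x y) : PowTwo (x + 1) (y + y) := by
  obtain ⟨c, d, h₀, hs, hx⟩ := h
  have htot : ∀ i, i ≤ x → ∃ z, Beta c d i z := by
    intro i hi
    rcases hi.lt_or_eq with hi | rfl
    · obtain ⟨z, -, hz, -⟩ := hs i hi
      exact ⟨z, hz⟩
    · exact ⟨y, hx⟩
  let R : M → M → Prop := fun i z => i ≤ x ∧ Beta c d i z ∨ i = x + 1 ∧ z = y + y
  have hR : Sigma1 (fun p : M × M => R p.1 p.2) := by
    have i := (IsTermFun.single (M := M)).fst (Γ := M)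
    have z := IsTermFun.snd (M := M) (Γ := M)
    exact Delta0.sigma1 (.or (.and (.le i (.const x)) (.beta (.const c) (.const d) i z))
      (.and (.eq i (.const _)) (.eq z (.const _))))
  have hb : ∀ i, i < x + 1 + 1 → ∃ z, z < c + y + y + 1 ∧ R i z := by
    intro i hi
    rcases (lt_succ_iff.1 hi).lt_or_eq with hi | rfl
    · obtain ⟨z, hz⟩ := htot i (lt_succ_iff.1 hi)
      refine ⟨z, lt_succ_iff.2 (hz.le.trans ?_), Or.inl ⟨lt_succ_iff.1 hi, hz⟩⟩
      rw [add_assoc]; exact le_self_add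
    · refine ⟨y + y, lt_succ_iff.2 ?_, Or.inr ⟨rfl, rfl⟩⟩
      rw [add_assoc]; exact le_add_self
  obtain ⟨c', d', h⟩ := exists_beta hR _ _ hb
  have hold : ∀ i z, i ≤ x → Beta c d i z → Beta c' d' i z := by
    intro i z hi hz
    obtain ⟨z', hz', h'⟩ := h i (lt_succ_iff.2 (hi.trans le_self_add))
    rcases h' with ⟨-, h'⟩ | ⟨rfl, -⟩
    · rwa [hz.unique h']
    · exact absurd hi (not_le.2 (lt_succ_iff.2 le_rfl))
  have hnew : Beta c' d' (x + 1) (y + y) := by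
    obtain ⟨z', hz', h'⟩ := h (x + 1) (lt_succ_iff.2 le_rfl)
    rcases h' with ⟨h', -⟩ | ⟨-, rfl⟩
    · exact absurd h' (not_le.2 (lt_succ_iff.2 le_rfl))
    · exact hz'
  refine ⟨c', d', hold 0 1 zero_le h₀, fun i hi => ?_, hnew⟩
  rcases (lt_succ_iff.1 hi).lt_or_eq with hi | rfl
  · obtain ⟨z, -, hz, hz'⟩ := hs i hi
    have := hold i z hi.le hz
    exact ⟨z, lt_succ_iff.2 this.le, this, hold _ _ (succ_le_iff.2 hi) hz'⟩
  · have := hold i y le_rfl hx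
    exact ⟨y, lt_succ_iff.2 this.le, this, hnew⟩

lemma exists_powTwo (x : M) : ∃ y, PowTwo x y := by
  revert x
  exact Sigma1.induction (.ex PowTwo.sigma1) ⟨1, powTwo_zero⟩ fun x ⟨y, hy⟩ => ⟨y + y, hy.succ⟩

variable (M) in
/-- The function `x ↦ 2 ^ x`. -/
noncomputable def exp (x : M) : M := (exists_powTwo x).choose

lemma powTwo_exp (x : M) : PowTwo x (exp M x) := (exists_powTwo x).choose_spec

lemma powTwo_iff {x y : M} : PowTwo x y ↔ y = exp M x :=
  ⟨fun h => h.unique (powTwo_exp x), fun h => h ▸ powTwo_exp x⟩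

lemma exp_zero : exp M 0 = 1 := (powTwo_iff.1 powTwo_zero).symm

lemma exp_succ (x : M) : exp M (x + 1) = 2 * exp M x := by
  rw [two_mul]; exact (powTwo_iff.1 (powTwo_exp x).succ).symm

/-- The complement of the graph of a total `Σ₁` function is `Σ₁`: some value other than the given
one is attained. -/
lemma delta1_exp : Delta1 (fun p : M × M => p.2 = exp M p.1) := by
  refine ⟨PowTwo.sigma1.congr fun _ => powTwo_iff, ?_⟩
  have : Sigma1 (fun p : M × M => ∃ y, PowTwo p.1 y ∧ y ≠ p.2) :=
    .ex (.and (PowTwo.sigma1.comp₂ (IsTermFun.single.fst.fst) .snd) (Delta0.eq .snd .var₁).not.sigma1)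
  exact this.congr fun p => by simp only [powTwo_iff, exists_eq_left]; exact ne_comm

/-- Substitution of a power of two in a `Σ₁`-relation. -/
lemma Sigma1.exp_arg {t : Γ → M} (ht : IsTermFun t) {P : Γ → M → Prop}
    (hP : Sigma1 (fun p : Γ × M => P p.1 p.2)) : Sigma1 (fun γ => P γ (exp M (t γ))) :=
  have h : Sigma1 (fun p : Γ × M => p.2 = exp M (t p.1)) :=
    delta1_exp.sigma.comp₂ (P := fun x y => y = exp M x) ht.fst .snd
  (Sigma1.ex (P := fun γ x => x = exp M (t γ) ∧ P γ x) (h.and hP)).congr fun γ => by simp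

lemma exp_pos (x : M) : 0 < exp M x := by
  revert x
  refine Sigma1.induction ?_ ?_ ?_
  · exact Sigma1.exp_arg .single (P := fun x y => 0 < y) (Delta0.lt (.const 0) .snd).sigma1
  · rw [exp_zero]; exact one_pos
  · intro x hx
    rw [exp_succ]; exact mul_pos two_pos hx

lemma lt_exp (x : M) : x < exp M x := by
  revert x
  refine Sigma1.induction ?_ ?_ ?_
  · exact Sigma1.exp_arg .single (P := fun x y => x < y) (Delta0.lt IsTermFun.single.fst .snd).sigma1
  · rw [exp_zero]; exact one_pos
  · intro x hx
    rw [exp_succ, two_mul]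
    exact add_lt_add_of_lt_of_le hx (one_le_of_pos (exp_pos x))

lemma exp_add (x y : M) : exp M (x + y) = exp M x * exp M y := by
  revert y
  refine Sigma1.induction ?_ ?_ ?_
  · refine Sigma1.exp_arg ((IsTermFun.const x).add .single) (P := fun y z => z = exp M x * exp M y) ?_
    refine Sigma1.exp_arg (IsTermFun.single.fst) (P := fun p w => p.2 = exp M x * w) ?_
    exact (Delta0.eq .var₁ ((IsTermFun.const _).mul .snd)).sigma1
  · rw [exp_zero, add_zero, mul_one]
  · intro y h
    rw [← add_assoc, exp_succ, exp_succ, h]; ring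

lemma exp_le_exp {x y : M} (h : x ≤ y) : exp M x ≤ exp M y := by
  obtain ⟨z, rfl⟩ := exists_add_of_le h
  rw [exp_add]
  exact le_mul_of_one_le_right' (one_le_of_pos (exp_pos z))

end Exp

section Sets

variable {M : Type*} [LA.Structure M] [hM : Fact (ModelsISigma1 M)] {Γ : Type*} [Ctx M Γ]

/-! ### Ackermann membership -/

lemma ackMem_iff {x y : M} : AckMem x y ↔ ∃ q r, r < exp M x ∧ y = (q + q + 1) * exp M x + r := by
  simp only [AckMem, powTwo_iff, exists_eq_left]
  refine exists_congr fun q => exists_congr fun r => ⟨fun h => h.2, fun h => ⟨?_, h⟩⟩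
  rw [lt_succ_iff, h.2]
  calc q ≤ q + q + 1 := by rw [add_assoc]; exact le_self_add
    _ ≤ (q + q + 1) * exp M x := le_mul_of_one_le_right' (one_le_of_pos (exp_pos x))
    _ ≤ _ := le_self_add

/-- A bit is `0` exactly when the quotient by `2 ^ x` is even. This existential form of the negation
makes `E` a `Δ₁` relation. -/
lemma not_ackMem_iff {x y : M} :
    ¬ AckMem x y ↔ ∃ q r, r < exp M x ∧ y = (q + q) * exp M x + r := by
  rw [ackMem_iff]
  constructor
  · intro h
    obtain ⟨p, r, hy, hr⟩ := exists_div (exp_pos x) y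
    obtain ⟨q, s, rfl, hs⟩ := exists_div (two_pos : (0 : M) < 2) p
    rcases eq_zero_or_pos' s with rfl | hs'
    · exact ⟨q, r, hr, by rw [hy]; ring⟩
    · obtain rfl : s = 1 := by
        refine le_antisymm ?_ (one_le_of_pos hs')
        rwa [← lt_succ_iff, one_add_one_eq_two]
      exact absurd ⟨q, r, hr, by rw [hy]; ring⟩ h
  · rintro ⟨q, r, hr, hy⟩ ⟨q', r', hr', hy'⟩
    have h := (div_unique hr hr' (hy.symm.trans hy')).1
    have h2 : q * 2 + 0 = q' * 2 + 1 := by rw [mul_two, mul_two, add_zero, h]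
    exact zero_ne_one (div_unique (two_pos : (0 : M) < 2) one_lt_two h2).2

lemma delta1_ackMem : Delta1 (fun p : M × M => AckMem p.1 p.2) := by
  have x := (IsTermFun.single (M := M)).fst (Γ := M)
  have y := IsTermFun.snd (M := M) (Γ := M)
  constructor
  · have : Sigma1 (fun p : M × M => ∃ q r, r < exp M p.1 ∧ p.2 = (q + q + 1) * exp M p.1 + r) := by
      refine .ex (.ex (Sigma1.exp_arg x.fst.fst
        (P := fun p e => p.2 < e ∧ p.1.1.2 = (p.1.2 + p.1.2 + 1) * e + p.2) ?_))
      exact Delta0.sigma1 (.and (.lt .var₁ .snd) (.eq .var₃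
        ((((IsTermFun.var₂.add .var₂).add (.const 1)).mul .snd).add .var₁)))
    exact this.congr fun p => ackMem_iff.symm
  · have : Sigma1 (fun p : M × M => ∃ q r, r < exp M p.1 ∧ p.2 = (q + q) * exp M p.1 + r) := by
      refine .ex (.ex (Sigma1.exp_arg x.fst.fst
        (P := fun p e => p.2 < e ∧ p.1.1.2 = (p.1.2 + p.1.2) * e + p.2) ?_))
      exact Delta0.sigma1 (.and (.lt .var₁ .snd) (.eq .var₃
        (((IsTermFun.var₂.add .var₂).mul .snd).add .var₁)))
    exact this.congr fun p => not_ackMem_iff.symm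

lemma AckMem.exp_le {x y : M} (h : AckMem x y) : exp M x ≤ y := by
  obtain ⟨q, r, -, rfl⟩ := ackMem_iff.1 h
  calc exp M x ≤ (q + q + 1) * exp M x := le_mul_of_one_le_left' le_add_self
    _ ≤ _ := le_self_add

lemma AckMem.lt {x y : M} (h : AckMem x y) : x < y := (lt_exp x).trans_le h.exp_le

/-- Below position `x` nothing changes, as `2 ^ x` is an even multiple of `2 ^ y`; above it nothing
changes, as setting a clear bit produces no carry. -/
lemma ackMem_add_exp {x α : M} (h : ¬ AckMem x α) (y : M) :
    AckMem y (α + exp M x) ↔ y = x ∨ AckMem y α := by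
  rcases lt_trichotomy y x with hyx | rfl | hxy
  · obtain ⟨δ, rfl⟩ := exists_add_of_le (succ_le_iff.2 hyx)
    have he : exp M (y + 1 + δ) = (exp M δ + exp M δ) * exp M y := by
      rw [exp_add, exp_succ]; ring
    have hne : ¬ y = y + 1 + δ := hyx.ne
    simp only [hne, false_or]
    constructor
    · contrapose
      rw [not_ackMem_iff, not_ackMem_iff]
      rintro ⟨q, r, hr, rfl⟩
      exact ⟨q + exp M δ, r, hr, by rw [he]; ring⟩
    · rw [ackMem_iff, ackMem_iff]
      rintro ⟨q, r, hr, rfl⟩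
      exact ⟨q + exp M δ, r, hr, by rw [he]; ring⟩
  · obtain ⟨q, r, hr, rfl⟩ := not_ackMem_iff.1 h
    simp only [true_or, iff_true]
    exact ackMem_iff.2 ⟨q, r, hr, by ring⟩
  · obtain ⟨δ, rfl⟩ := exists_add_of_le (succ_le_iff.2 hxy)
    obtain ⟨q, r, hr, hα⟩ := not_ackMem_iff.1 h
    set e := exp M x with he
    have hf : exp M (x + 1 + δ) = exp M δ * (e + e) := by rw [exp_add, exp_succ]; ring
    -- No carry: modulo `2 e` the remainder `s` agrees with `α`, so it leaves `r < e`. As `2 e`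
    -- divides `2 ^ (x + 1 + δ)`, adding `e` to `s` stays below that power.
    have key : ∀ p s, s < exp M (x + 1 + δ) → α = p * exp M (x + 1 + δ) + s →
        s + e < exp M (x + 1 + δ) := by
      intro p s hs hα'
      have hpos : 0 < e + e := add_pos (exp_pos x) (exp_pos x)
      obtain ⟨t, u, rfl, hu⟩ := exists_div hpos s
      have hru : (p * exp M δ + t) * (e + e) + u = q * (e + e) + r := by
        calc _ = p * exp M (x + 1 + δ) + (t * (e + e) + u) := by rw [hf]; ring
          _ = α := hα'.symm
          _ = _ := by rw [hα]; ring
      obtain rfl := (div_unique hu (hr.trans_le le_self_add) hru).2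
      rw [hf] at hs ⊢
      have ht : t < exp M δ := by
        by_contra! ht
        exact absurd (hs.trans_le (mul_le_mul_left ht (e + e))) (not_lt.2 le_self_add)
      calc t * (e + e) + u + e < t * (e + e) + e + e := by
            exact add_lt_add_left (add_lt_add_right hr _) _
        _ = (t + 1) * (e + e) := by ring
        _ ≤ _ := mul_le_mul_left (succ_le_iff.2 ht) _
    have hne : ¬ x + 1 + δ = x := hxy.ne'
    simp only [hne, false_or]
    constructor
    · contrapose
      rw [not_ackMem_iff, not_ackMem_iff]
      rintro ⟨p, s, hs, hα'⟩
      exact ⟨p, s + e, key _ _ hs hα', by rw [hα']; ring⟩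
    · rw [ackMem_iff, ackMem_iff]
      rintro ⟨p, s, hs, hα'⟩
      exact ⟨p, s + e, key _ _ hs hα', by rw [hα']; ring⟩

/-- `Δ₁`-comprehension for bounded sets. -/
theorem exists_code {P : M → Prop} (hP : Delta1 P) (u : M) :
    ∃ s : M, ∀ x, AckMem x s ↔ x < u ∧ P x := by
  -- The bound `s < 2 ^ u` ensures that bit `u` is clear when `2 ^ u` is added, and that the final
  -- code has no members from `u` on.
  have key : ∀ u, ∃ s, s < exp M u ∧ ∀ x, x < u → (AckMem x s ↔ P x) := by
    refine Sigma1.induction ?_ ⟨0, exp_pos 0, fun x h => absurd h not_lt_zero⟩ ?_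
    · refine .ex (.and ?_ (.ball IsTermFun.single.fst (Delta1.sigma (.iff ?_ ?_))))
      · exact Sigma1.exp_arg IsTermFun.single.fst (P := fun p e => p.2 < e)
          (Delta0.lt .var₁ .snd).sigma1
      · exact delta1_ackMem.comp₂ .snd .var₁
      · exact hP.comp (.single .snd)
    · rintro u ⟨s, hs, h⟩
      have hus : ¬ AckMem u s := fun h => absurd hs (not_lt.2 h.exp_le)
      by_cases hPu : P u
      · refine ⟨s + exp M u, ?_, fun x hx => ?_⟩
        · rw [exp_succ, two_mul]
          exact add_lt_add_left hs _
        · rw [ackMem_add_exp hus]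
          rcases (lt_succ_iff.1 hx).lt_or_eq with hx | rfl
          · rw [← h x hx]
            simp [hx.ne]
          · simp [hPu]
      · refine ⟨s, hs.trans_le (exp_le_exp le_self_add), fun x hx => ?_⟩
        rcases (lt_succ_iff.1 hx).lt_or_eq with hx | rfl
        · exact h x hx
        · simp [hPu, hus]
  obtain ⟨s, hs, h⟩ := key u
  refine ⟨s, fun x => ⟨fun hx => ?_, fun hx => (h x hx.1).2 hx.2⟩⟩
  have hxu : x < u := by
    by_contra! hux
    exact absurd (hs.trans_le (exp_le_exp hux)) (not_lt.2 hx.exp_le)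
  exact ⟨hxu, (h x hxu).1 hx⟩

/-! ### Ordered pairs and coded functions -/

lemma add_self_injective {x y : M} (h : x + x = y + y) : x = y := by
  have := div_unique (two_pos : (0 : M) < 2) two_pos
    (show x * 2 + 0 = y * 2 + 0 by rw [mul_two, mul_two, h])
  exact this.1

lemma exists_pair (x y : M) : ∃ p, IsPair x y p := by
  obtain ⟨k, s, h, hs⟩ := exists_div (two_pos : (0 : M) < 2) (x + y)
  rcases eq_zero_or_pos' s with rfl | hs'
  · refine ⟨k * (x + y + 1) + y, ?_⟩
    rw [IsPair, h]; ring
  · obtain rfl : s = 1 := by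
      refine le_antisymm ?_ (one_le_of_pos hs')
      rwa [← lt_succ_iff, one_add_one_eq_two]
    refine ⟨(x + y) * (k + 1) + y, ?_⟩
    rw [IsPair, h]; ring

lemma IsPair.unique {x y p p' : M} (h : IsPair x y p) (h' : IsPair x y p') : p = p' :=
  add_self_injective (Eq.trans h (Eq.symm h'))

/-- Pairs on a diagonal `x + y` have smaller codes than those on any later diagonal, so the code
determines `x + y` and then `y`. -/
lemma IsPair.injective {x y x' y' p : M} (h : IsPair x y p) (h' : IsPair x' y' p) :
    x = x' ∧ y = y' := by
  have key : ∀ {x y x' y' p : M}, IsPair x y p → IsPair x' y' p → ¬ x + y < x' + y' := by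
    intro x y x' y' p h h' hlt
    obtain ⟨e, he⟩ := exists_add_of_le (succ_le_iff.2 hlt)
    have h₁ : p + p < p + p := by
      calc p + p = (x + y) * (x + y + 1) + (y + y) := h
        _ < (x + y) * (x + y + 1) + (y + y) + (x + x + 2) :=
          lt_add_of_pos_right _ (lt_of_lt_of_le two_pos le_add_self)
        _ = (x + y + 1) * (x + y + 1 + 1) := by ring
        _ ≤ (x' + y') * (x' + y' + 1) := by
          rw [he]
          exact mul_le_mul' le_self_add (add_le_add_left le_self_add 1)
        _ ≤ (x' + y') * (x' + y' + 1) + (y' + y') := le_self_add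
        _ = p + p := h'.symm
    exact lt_irrefl _ h₁
  have hs : x + y = x' + y' := le_antisymm (not_lt.1 (key h' h)) (not_lt.1 (key h h'))
  have hy : y = y' := by
    have : (x' + y') * (x' + y' + 1) + (y + y) = (x' + y') * (x' + y' + 1) + (y' + y') := by
      rw [← hs]
      exact h.symm.trans (h'.trans (by rw [hs]))
    exact add_self_injective (add_left_cancel this)
  subst hy
  exact ⟨add_right_cancel hs, rfl⟩

lemma IsPair.snd_le {x y p : M} (h : IsPair x y p) : y ≤ p := by
  by_contra! hlt
  have : p + p < y + y := add_lt_add hlt hlt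
  rw [show p + p = _ from h] at this
  exact absurd this (not_lt.2 le_add_self)

lemma Delta0.isPair {x y p : Γ → M} (hx : IsTermFun x) (hy : IsTermFun y) (hp : IsTermFun p) :
    Delta0 (fun γ => IsPair (x γ) (y γ) (p γ)) :=
  .eq (hp.add hp) (((hx.add hy).mul ((hx.add hy).add (.const 1))).add (hy.add hy))

lemma app_iff {f x y p : M} (h : IsPair x y p) : App f x y ↔ AckMem p f :=
  ⟨fun ⟨_, hq, hm⟩ => (h.unique hq) ▸ hm, fun hm => ⟨p, h, hm⟩⟩

lemma App.lt {f x y : M} (h : App f x y) : y < f := by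
  obtain ⟨p, hp, h⟩ := h
  exact hp.snd_le.trans_lt h.lt

lemma delta1_app : Delta1 (fun p : (M × M) × M => App p.1.1 p.1.2 p.2) := by
  have pair : Delta0 (fun p : ((M × M) × M) × M => IsPair p.1.1.2 p.1.2 p.2) :=
    .isPair .var₂ .var₁ .snd
  have mem := delta1_ackMem.comp₂ (Γ := ((M × M) × M) × M) .snd IsTermFun.single.fst.fst.fst
  refine ⟨.ex (pair.sigma1.and mem.sigma), (Sigma1.ex (P := fun q p => IsPair q.1.2 q.2 p ∧
    ¬ AckMem p q.1.1) (pair.sigma1.and mem.pi)).congr ?_⟩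
  rintro ⟨⟨f, x⟩, y⟩
  obtain ⟨p, hp⟩ := exists_pair x y
  simp only [app_iff hp]
  exact ⟨fun ⟨q, hq, h⟩ => (hp.unique hq) ▸ h, fun h => ⟨p, hp, h⟩⟩

/-- A `Δ₁`-definable function on an initial segment with bounded values is coded. -/
theorem exists_codedFun {D : M → M → Prop} (hD : Delta1 (fun p : M × M => D p.1 p.2)) (a b : M)
    (hfun : ∀ k j j', D k j → D k j' → j = j') :
    ∃ f : M, IsCodedFun f ∧ ∀ k j, App f k j ↔ k < a ∧ j < b ∧ D k j := by
  have hdef : Delta1 (fun p : M => ∃ k, k < a ∧ ∃ j, j < b ∧ IsPair k j p ∧ D k j) := by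
    refine .bex (.const a) (.bex (.const b) (.and (Delta0.delta1 (.isPair .var₁ .snd ?_)) ?_))
    · exact IsTermFun.single.fst.fst
    · exact hD.comp₂ .var₁ .snd
  obtain ⟨f, hf⟩ := exists_code hdef ((a + b) * (a + b + 1) + (b + b) + 1)
  have happ : ∀ k j, App f k j ↔ k < a ∧ j < b ∧ D k j := by
    intro k j
    obtain ⟨p, hp⟩ := exists_pair k j
    rw [app_iff hp, hf]
    constructor
    · rintro ⟨-, k', hk', j', hj', hp', hD⟩
      obtain ⟨rfl, rfl⟩ := hp.injective hp'
      exact ⟨hk', hj', hD⟩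
    · rintro ⟨hk, hj, hD⟩
      refine ⟨lt_succ_iff.2 ?_, k, hk, j, hj, hp, hD⟩
      calc p ≤ p + p := le_self_add
        _ = (k + j) * (k + j + 1) + (j + j) := hp
        _ ≤ _ := by gcongr
  exact ⟨f, fun k j j' h h' => hfun k j j' ((happ k j).1 h).2.2 ((happ k j').1 h').2.2, happ⟩

end Sets

/-! ### Formulas for exponentiation and Ackermann membership -/

section Formulas

variable {n : ℕ}

/-- The term `s + t`. -/
def addTerm (s t : LA.Term (ℕ ⊕ Fin n)) : LA.Term (ℕ ⊕ Fin n) := addSymb.apply₂ s t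

/-- The term `s * t`. -/
def mulTerm (s t : LA.Term (ℕ ⊕ Fin n)) : LA.Term (ℕ ⊕ Fin n) := mulSymb.apply₂ s t

/-- The term `0`. -/
def zeroTerm : LA.Term (ℕ ⊕ Fin n) := Term.func zeroSymb ![]

/-- The term `1`. -/
def oneTerm : LA.Term (ℕ ⊕ Fin n) := Term.func oneSymb ![]

/-- `t`, as a term with one more variable. -/
def weaken (t : LA.Term (ℕ ⊕ Fin n)) : LA.Term (ℕ ⊕ Fin (n + 1)) :=
  t.relabel (Sum.map id Fin.castSucc)

/-- The term consisting of the last variable. -/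
def lastVar : LA.Term (ℕ ⊕ Fin (n + 1)) := Term.var (Sum.inr (Fin.last n))

/-- The formula `∃ x < t, φ`. -/
def bexFormula (t : LA.Term (ℕ ⊕ Fin n)) (φ : LA.BoundedFormula ℕ (n + 1)) :
    LA.BoundedFormula ℕ n := (newLt t ⊓ φ).ex

/-- The formula `∀ x < t, φ`. -/
def ballFormula (t : LA.Term (ℕ ⊕ Fin n)) (φ : LA.BoundedFormula ℕ (n + 1)) :
    LA.BoundedFormula ℕ n := ((newLt t).imp φ).all

lemma IsDelta0.inf {φ ψ : LA.BoundedFormula ℕ n} (hφ : IsDelta0 φ) (hψ : IsDelta0 ψ) :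
    IsDelta0 (φ ⊓ ψ) := (hφ.imp (hψ.imp .falsum)).imp .falsum

lemma isDelta0_lt (s t : LA.Term (ℕ ⊕ Fin n)) : IsDelta0 (ltFormula s t) :=
  .atomic (.rel _ _)

lemma isDelta0_eq (s t : LA.Term (ℕ ⊕ Fin n)) : IsDelta0 (s.bdEqual t) :=
  .atomic (.equal _ _)

/-- The formula `Beta c d i z`. -/
def betaFormula (c d i z : LA.Term (ℕ ⊕ Fin n)) : LA.BoundedFormula ℕ n :=
  ltFormula z (addTerm oneTerm (mulTerm (addTerm i oneTerm) d)) ⊓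
    bexFormula (addTerm c oneTerm) ((weaken c).bdEqual
      (addTerm (mulTerm lastVar (weaken (addTerm oneTerm (mulTerm (addTerm i oneTerm) d))))
        (weaken z)))

/-- The formula expressing that `c`, `d` code the powers of two up to `2 ^ x = y`. -/
def powTwoBody (x y c d : LA.Term (ℕ ⊕ Fin n)) : LA.BoundedFormula ℕ n :=
  betaFormula c d zeroTerm oneTerm ⊓
    (ballFormula x (bexFormula (weaken (addTerm c oneTerm))
      (betaFormula (weaken (weaken c)) (weaken (weaken d)) (weaken lastVar) lastVar ⊓
        betaFormula (weaken (weaken c)) (weaken (weaken d)) (addTerm (weaken lastVar) oneTerm)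
          (addTerm lastVar lastVar))) ⊓
    betaFormula c d x y)

lemma isDelta0_beta (c d i z : LA.Term (ℕ ⊕ Fin n)) : IsDelta0 (betaFormula c d i z) :=
  (isDelta0_lt _ _).inf (.bex _ (isDelta0_eq _ _))

lemma isDelta0_powTwoBody (x y c d : LA.Term (ℕ ⊕ Fin n)) : IsDelta0 (powTwoBody x y c d) :=
  (isDelta0_beta _ _ _ _).inf
    ((IsDelta0.ball _ (.bex _ ((isDelta0_beta _ _ _ _).inf (isDelta0_beta _ _ _ _)))).inf
      (isDelta0_beta _ _ _ _))

/-- The formula `PowTwo x y`. -/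
def powTwoFormula (x y : LA.Term (ℕ ⊕ Fin n)) : LA.BoundedFormula ℕ n :=
  (powTwoBody (weaken (weaken x)) (weaken (weaken y)) (weaken lastVar) lastVar).ex.ex

/-- The formula `AckMem x y`. -/
def ackMemFormula (x y : LA.Term (ℕ ⊕ Fin n)) : LA.BoundedFormula ℕ n :=
  (powTwoBody (weaken (weaken (weaken x))) (weaken (weaken lastVar)) (weaken lastVar) lastVar ⊓
    bexFormula (addTerm (weaken (weaken (weaken y))) oneTerm)
      (bexFormula (weaken (weaken (weaken lastVar)))
        ((weaken (weaken (weaken (weaken (weaken y))))).bdEqual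
          (addTerm (mulTerm (addTerm (addTerm (weaken lastVar) (weaken lastVar)) oneTerm)
            (weaken (weaken (weaken (weaken lastVar))))) lastVar)))).ex.ex.ex

lemma isSigma1_powTwo (x y : LA.Term (ℕ ⊕ Fin n)) : IsSigma1 (powTwoFormula x y) :=
  .ex (.ex (.delta0 (isDelta0_powTwoBody _ _ _ _)))

lemma isSigma1_ackMem (x y : LA.Term (ℕ ⊕ Fin n)) : IsSigma1 (ackMemFormula x y) :=
  .ex (.ex (.ex (.delta0 ((isDelta0_powTwoBody _ _ _ _).inf
    (IsDelta0.bex _ (.bex _ (isDelta0_eq _ _)))))))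

variable {N : Type*} [LA.Structure N] (v : ℕ → N) (xs : Fin n → N)

lemma realize_addTerm (s t : LA.Term (ℕ ⊕ Fin n)) :
    (addTerm s t).realize (Sum.elim v xs) =
      s.realize (Sum.elim v xs) + t.realize (Sum.elim v xs) := Term.realize_functions_apply₂

lemma realize_mulTerm (s t : LA.Term (ℕ ⊕ Fin n)) :
    (mulTerm s t).realize (Sum.elim v xs) =
      s.realize (Sum.elim v xs) * t.realize (Sum.elim v xs) := Term.realize_functions_apply₂

lemma realize_zeroTerm : (zeroTerm : LA.Term (ℕ ⊕ Fin n)).realize (Sum.elim v xs) = 0 :=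
  congrArg (Structure.funMap zeroSymb) (Subsingleton.elim _ _)

lemma realize_oneTerm : (oneTerm : LA.Term (ℕ ⊕ Fin n)).realize (Sum.elim v xs) = 1 :=
  congrArg (Structure.funMap oneSymb) (Subsingleton.elim _ _)

lemma realize_weaken (t : LA.Term (ℕ ⊕ Fin n)) (x : N) :
    (weaken t).realize (Sum.elim v (Fin.snoc xs x : Fin (n + 1) → N)) =
      t.realize (Sum.elim v xs) := by
  rw [weaken, Term.realize_relabel]
  congr 1
  funext y
  rcases y with y | y <;> simp

lemma realize_lastVar (x : N) :
    (lastVar : LA.Term (ℕ ⊕ Fin (n + 1))).realize (Sum.elim v (Fin.snoc xs x : Fin (n + 1) → N)) =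
      x := by simp [lastVar]

lemma realize_ltFormula (s t : LA.Term (ℕ ⊕ Fin n)) :
    (ltFormula s t).Realize v xs ↔ s.realize (Sum.elim v xs) < t.realize (Sum.elim v xs) :=
  BoundedFormula.realize_rel₂

lemma realize_bexFormula (t : LA.Term (ℕ ⊕ Fin n)) (φ : LA.BoundedFormula ℕ (n + 1)) :
    (bexFormula t φ).Realize v xs ↔
      ∃ x, x < t.realize (Sum.elim v xs) ∧ φ.Realize v (Fin.snoc xs x) := by
  simp only [bexFormula, BoundedFormula.realize_ex, BoundedFormula.realize_inf, realize_newLt]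

lemma realize_ballFormula (t : LA.Term (ℕ ⊕ Fin n)) (φ : LA.BoundedFormula ℕ (n + 1)) :
    (ballFormula t φ).Realize v xs ↔
      ∀ x, x < t.realize (Sum.elim v xs) → φ.Realize v (Fin.snoc xs x) := by
  simp only [ballFormula, BoundedFormula.realize_all, BoundedFormula.realize_imp, realize_newLt]

lemma realize_betaFormula (c d i z : LA.Term (ℕ ⊕ Fin n)) :
    (betaFormula c d i z).Realize v xs ↔
      Beta (c.realize (Sum.elim v xs)) (d.realize (Sum.elim v xs)) (i.realize (Sum.elim v xs))
        (z.realize (Sum.elim v xs)) := by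
  simp only [betaFormula, BoundedFormula.realize_inf, realize_ltFormula, realize_bexFormula,
    BoundedFormula.realize_bdEqual, realize_addTerm, realize_mulTerm, realize_oneTerm,
    realize_weaken, realize_lastVar, Beta]

lemma realize_powTwoFormula (x y : LA.Term (ℕ ⊕ Fin n)) :
    (powTwoFormula x y).Realize v xs ↔
      PowTwo (x.realize (Sum.elim v xs)) (y.realize (Sum.elim v xs)) := by
  simp only [powTwoFormula, powTwoBody, BoundedFormula.realize_ex, BoundedFormula.realize_inf,
    realize_bexFormula, realize_ballFormula, realize_betaFormula, realize_addTerm,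
    realize_zeroTerm, realize_oneTerm, realize_weaken, realize_lastVar, PowTwo]

lemma realize_ackMemFormula (x y : LA.Term (ℕ ⊕ Fin n)) :
    (ackMemFormula x y).Realize v xs ↔
      AckMem (x.realize (Sum.elim v xs)) (y.realize (Sum.elim v xs)) := by
  simp only [ackMemFormula, powTwoBody, BoundedFormula.realize_ex, BoundedFormula.realize_inf,
    realize_bexFormula, realize_ballFormula, realize_betaFormula, realize_addTerm,
    realize_mulTerm, BoundedFormula.realize_bdEqual,
    realize_zeroTerm, realize_oneTerm, realize_weaken, realize_lastVar, AckMem, PowTwo]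
  -- For the formula to be `Σ₁`, its quantifiers over the `β`-code stand in front of the whole
  -- matrix; in `AckMem` they govern only `PowTwo`.
  simp only [exists_and_right, exists_and_left]

end Formulas

/-! ### `Σ₁`-elementary submodels -/

section Elementary

variable {M : Type*} [LA.Structure M] {M₀ : LA.Substructure M}

lemma IsSigma1Elementary.powTwo_iff (hel : IsSigma1Elementary M₀) (x y : M₀) :
    PowTwo (x : M) y ↔ PowTwo x y := by
  have := hel (powTwoFormula (Term.var (Sum.inl 0)) (Term.var (Sum.inl 1))) (isSigma1_powTwo _ _)
    (fun k => if k = 0 then x else y)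
  simp only [Formula.Realize, realize_powTwoFormula, Term.realize_var, Sum.elim_inl, if_true,
    one_ne_zero, if_false] at this
  exact this.symm

lemma IsSigma1Elementary.ackMem_iff (hel : IsSigma1Elementary M₀) (x y : M₀) :
    AckMem (x : M) y ↔ AckMem x y := by
  have := hel (ackMemFormula (Term.var (Sum.inl 0)) (Term.var (Sum.inl 1))) (isSigma1_ackMem _ _)
    (fun k => if k = 0 then x else y)
  simp only [Formula.Realize, realize_ackMemFormula, Term.realize_var, Sum.elim_inl, if_true,
    one_ne_zero, if_false] at this
  exact this.symm

/-- Elementarity is applied to the `Σ₁`-formula asserting that the power exists; this makes `M₀`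
closed under `2 ^ x`. -/
lemma IsSigma1Elementary.exists_powTwo (hel : IsSigma1Elementary M₀) (x : M₀)
    (h : ∃ y : M, PowTwo (x : M) y) : ∃ y ∈ M₀, PowTwo (x : M) y := by
  have := hel (powTwoFormula (Term.var (Sum.inl 0)) lastVar).ex (.ex (isSigma1_powTwo _ _))
    (fun _ => x)
  simp only [Formula.Realize, BoundedFormula.realize_ex, realize_powTwoFormula, realize_lastVar,
    Term.realize_var, Sum.elim_inl] at this
  obtain ⟨y, hy⟩ := this.2 h
  exact ⟨y, y.2, (hel.powTwo_iff x y).2 hy⟩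

lemma zero_mem_substructure (M₀ : LA.Substructure M) : (0 : M) ∈ M₀ :=
  M₀.fun_mem zeroSymb ![] (fun i => i.elim0)

lemma add_mem_substructure {x y : M} (hx : x ∈ M₀) (hy : y ∈ M₀) : x + y ∈ M₀ :=
  M₀.fun_mem addSymb ![x, y] fun i => by fin_cases i <;> assumption

end Elementary

/-! ### The induction along a strong cut -/

section Main

variable {M : Type*} [LA.Structure M] [hM : Fact (ModelsISigma1 M)]

lemma IsCut.zero_mem {I : Set M} (hI : IsCut I) : (0 : M) ∈ I := by
  obtain ⟨x, hx⟩ := hI.nonempty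
  rcases eq_zero_or_pos' x with rfl | h
  · exact hx
  · exact hI.initial 0 x h hx

lemma IsCut.lt_of_notMem {I : Set M} (hI : IsCut I) {a i : M} (ha : a ∉ I) (hi : i ∈ I) :
    i < a := by
  by_contra! h
  rcases h.lt_or_eq with h | rfl
  · exact ha (hI.initial _ _ h hi)
  · exact ha hi

lemma entry_eq_zero {a i : M} (h : ¬ (IsSeq a ∧ ∃ z : M, App a i z)) : entry a i = 0 := dif_neg h

lemma app_entry {a i : M} (h : IsSeq a ∧ ∃ z : M, App a i z) : App a i (entry a i) := by
  rw [entry, dif_pos h]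
  exact h.2.choose_spec

/-- If the entries of `a` at the elements of a cut are distinct, then `a` is a sequence number whose
length exceeds the cut. -/
lemma isSeq_of_injective {I : Set M} (hI : IsCut I) {a : M}
    (hinj : ∀ i ∈ I, ∀ j ∈ I, i ≠ j → entry a i ≠ entry a j) :
    IsSeq a ∧ ∀ i ∈ I, App a i (entry a i) := by
  have hseq : IsSeq a := by
    by_contra h
    -- If `a` is not a sequence number, its entries at `0` and `1` are both the default `0`.
    refine hinj 0 hI.zero_mem (0 + 1) (hI.succ 0 hI.zero_mem) ?_ ?_
    · rw [zero_add]; exact zero_ne_one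
    · rw [entry_eq_zero fun h' => h h'.1, entry_eq_zero fun h' => h h'.1]
  refine ⟨hseq, fun i hi => app_entry ⟨hseq, ?_⟩⟩
  obtain ⟨-, l, hl⟩ := hseq
  by_contra h
  -- If `i` is beyond the length, so is `i + 1`, and both entries are the default `0`.
  have h' : ¬ ∃ z, App a (i + 1) z := by
    rw [hl] at h ⊢
    exact fun h' => h ((lt_succ_iff.2 le_rfl).trans h')
  refine hinj i hi (i + 1) (hI.succ i hi) (lt_succ_iff.2 le_rfl).ne ?_
  rw [entry_eq_zero fun h₁ => h h₁.2, entry_eq_zero fun h₁ => h' h₁.2]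

/-- `β` codes the set of those `x E ξ` which occur among the first `k` entries of `a`. -/
def CodesInitial (a ξ k β : M) : Prop :=
  ∀ x, x < β + ξ → (AckMem x β ↔ AckMem x ξ ∧ ∃ i, i < k ∧ App a i x)

/-- Members of `β` and `ξ` lie below these numbers, so the bound `β + ξ`, which makes the relation
`Δ₁`, loses nothing. -/
lemma codesInitial_iff {a ξ k β : M} : CodesInitial a ξ k β ↔
    ∀ x, AckMem x β ↔ AckMem x ξ ∧ ∃ i, i < k ∧ App a i x := by
  refine ⟨fun h x => ?_, fun h x _ => h x⟩
  rcases lt_or_ge x (β + ξ) with hx | hx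
  · exact h x hx
  · have h₁ : ¬ AckMem x β := fun h => absurd h.lt (not_lt.2 (le_self_add.trans hx))
    have h₂ : ¬ AckMem x ξ := fun h => absurd h.lt (not_lt.2 (le_add_self.trans hx))
    simp [h₁, h₂]

lemma delta1_codesInitial (a ξ : M) :
    Delta1 (fun p : M × M => CodesInitial a ξ p.1 p.2) := by
  refine .ball (IsTermFun.snd.add (.const ξ)) (.iff ?_ (.and ?_ (.bex ?_ ?_)))
  · exact delta1_ackMem.comp₂ .snd .var₁
  · exact delta1_ackMem.comp₂ .snd (.const ξ)
  · exact IsTermFun.single.fst.fst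
  · exact delta1_app.comp₃ (.const a) .snd .var₁

/-- The `j`-th entry of `a` codes the set of those `x E ξ` which occur among the first `k` entries
of `a`. -/
def EntryCodesInitial (a ξ k j : M) : Prop :=
  ∃ β, β < a ∧ App a j β ∧ CodesInitial a ξ k β

lemma delta1_entryCodesInitial (a ξ : M) :
    Delta1 (fun p : M × M => EntryCodesInitial a ξ p.1 p.2) := by
  refine .bex (.const a) (.and ?_ ?_)
  · exact delta1_app.comp₃ (.const a) .var₁ .snd
  · exact (delta1_codesInitial a ξ).comp₂ IsTermFun.single.fst.fst .snd

/-- The function which assigns to `k < a` the least `j < a` such that the `j`-th entry of `a` codes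
the set of those `x E ξ` which occur among the first `k` entries of `a`, and `a` if there is no such
`j`, is coded. -/
lemma exists_leastIndex (a ξ : M) : ∃ f : M, IsCodedFun f ∧ ∀ k, k < a → ∃ j, App f k j ∧
    (EntryCodesInitial a ξ k j ∨ j = a) ∧ ∀ i, EntryCodesInitial a ξ k i → j ≤ i := by
  -- The alternative `j = a` makes the least-index function total on `k < a`; the default lies
  -- outside every cut omitting `a`.
  let H : M → M → Prop := fun k j => EntryCodesInitial a ξ k j ∨ j = a
  have hH : Delta1 (fun p : M × M => H p.1 p.2) :=
    (delta1_entryCodesInitial a ξ).or (Delta0.eq .snd (.const a)).delta1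
  have hD : Delta1 (fun p : M × M => H p.1 p.2 ∧ ∀ i, i < p.2 → ¬ H p.1 i) :=
    hH.and (.ball .snd (hH.comp₂ IsTermFun.single.fst.fst .snd).not)
  obtain ⟨f, hf, happ⟩ := exists_codedFun
    (D := fun k j => H k j ∧ ∀ i, i < j → ¬ H k i) hD a (a + 1) fun k j j' ⟨h₁, h₂⟩ ⟨h₁', h₂'⟩ =>
    le_antisymm (not_lt.1 fun h => h₂ _ h h₁') (not_lt.1 fun h => h₂' _ h h₁)
  refine ⟨f, hf, fun k hk => ?_⟩
  obtain ⟨j, hj, hmin⟩ := (hH.comp (r := fun j => (k, j))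
    ((IsSubst.single (.const k)).prod .single)).exists_least (x := a) (Or.inr rfl)
  have hle : ∀ i, H k i → j ≤ i := fun i hi => not_lt.1 fun h => hmin i h hi
  exact ⟨j, (happ k j).2 ⟨hk, lt_succ_iff.2 (hle a (Or.inr rfl)), hj, hmin⟩, hj,
    fun i hi => hle i (Or.inl hi)⟩

lemma CodesInitial.succ {a ξ k β z : M} (hk : ∀ x, App a k x ↔ x = z)
    (h : CodesInitial a ξ k β) :
    CodesInitial a ξ (k + 1) β ∨ CodesInitial a ξ (k + 1) (β + exp M z) := by
  rw [codesInitial_iff] at h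
  have hs : ∀ x, (∃ i, i < k + 1 ∧ App a i x) ↔ x = z ∨ ∃ i, i < k ∧ App a i x := by
    intro x
    simp only [← hk, lt_succ_iff, le_iff_lt_or_eq]
    constructor
    · rintro ⟨i, hi | rfl, hx⟩
      · exact Or.inr ⟨i, hi, hx⟩
      · exact Or.inl hx
    · rintro (hx | ⟨i, hi, hx⟩)
      · exact ⟨k, Or.inr rfl, hx⟩
      · exact ⟨i, Or.inl hi, hx⟩
  -- The power is added only if `z` is a new member; adding it when bit `z` is already set would
  -- cause a carry.
  by_cases hz : AckMem z ξ ∧ ¬ AckMem z β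
  · refine Or.inr (codesInitial_iff.2 fun x => ?_)
    rw [ackMem_add_exp hz.2, hs, h]
    by_cases hx : x = z
    · simp [hx, hz.1]
    · simp [hx]
  · refine Or.inl (codesInitial_iff.2 fun x => ?_)
    rw [hs]
    by_cases hx : x = z
    · subst hx
      have := h x
      tauto
    · simp [hx, h]

/-- A subset of `M₀` is coded by an element of `M₀` if it is coded in `M` and contained in the set
of the entries of `a` with index below some element of `I`. -/
theorem exists_code_mem {I : Set M} (hI : IsStrongCut I) {a : M} (ha : a ∉ I)
    (hinj : ∀ i ∈ I, ∀ j ∈ I, i ≠ j → entry a i ≠ entry a j) {M₀ : LA.Substructure M}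
    (hM₀ : (M₀ : Set M) = {z : M | ∃ i ∈ I, z = entry a i}) (hel : IsSigma1Elementary M₀)
    {X : Set M} (hXM₀ : X ⊆ (M₀ : Set M)) (hX : IsCoded X) {i₀ : M} (hi₀ : i₀ ∈ I)
    (hXi₀ : ∀ i ∈ I, entry a i ∈ X → i < i₀) : ∃ α ∈ M₀, Codes α X := by
  have hcut := hI.toIsCut
  obtain ⟨hseq, happ⟩ := isSeq_of_injective hcut hinj
  have hunique : ∀ i ∈ I, ∀ z, App a i z ↔ z = entry a i := fun i hi z =>
    ⟨fun h => hseq.1 i _ _ h (happ i hi), fun h => h ▸ happ i hi⟩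
  have hmem : ∀ z, z ∈ M₀ ↔ ∃ i ∈ I, z = entry a i := fun z => Set.ext_iff.1 hM₀ z
  obtain ⟨ξ, hξ⟩ := hX
  obtain ⟨f, hf, hleast⟩ := exists_leastIndex a ξ
  obtain ⟨e, hIe, hfe⟩ := hI.strong f hf fun i hi =>
    (hleast i (hcut.lt_of_notMem ha hi)).imp fun _ h => h.1
  -- An index `j < e` may lie outside `I`, but the least one, `f(k) ≤ j < e`, lies in `I` by the
  -- choice of `e`. In particular it is not the default `a`, so the entry there belongs to `M₀`.
  have toMem : ∀ k ∈ I, (∃ j, j < e ∧ EntryCodesInitial a ξ k j) →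
      ∃ β ∈ M₀, CodesInitial a ξ k β := by
    rintro k hk ⟨j, hj, hkj⟩
    obtain ⟨m, hfm, hm, hmin⟩ := hleast k (hcut.lt_of_notMem ha hk)
    have hmI : m ∈ I := (hfe k hk m hfm).2 ((hmin j hkj).trans_lt hj)
    rcases hm with ⟨β, -, hβ, h⟩ | rfl
    · exact ⟨β, (hmem β).2 ⟨m, hmI, (hunique m hmI β).1 hβ⟩, h⟩
    · exact absurd hmI ha
  have ofMem : ∀ k, ∀ β ∈ M₀, CodesInitial a ξ k β →
      ∃ j, j < e ∧ EntryCodesInitial a ξ k j := by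
    intro k β hβ h
    obtain ⟨j, hj, rfl⟩ := (hmem β).1 hβ
    exact ⟨j, hIe j hj, _, (happ j hj).lt, happ j hj, h⟩
  -- With `e` in place of `I` the induction hypothesis is `Σ₁`. The step passes to a code in `M₀` by
  -- `toMem`, extends it there, and returns by `ofMem`.
  have key : ∀ k, i₀ < k ∨ ∃ j, j < e ∧ EntryCodesInitial a ξ k j := by
    refine Sigma1.induction ?_ (Or.inr ?_) ?_
    · exact .or (Delta0.lt (.const i₀) .single).sigma1
        (.bex (.const e) (delta1_entryCodesInitial a ξ).sigma)
    · refine ofMem 0 0 (zero_mem_substructure M₀) (codesInitial_iff.2 fun x => ?_)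
      have : ¬ AckMem x (0 : M) := fun h => absurd h.lt not_lt_zero
      simp [this]
    · rintro k (hk | hk)
      · exact Or.inl (hk.trans (lt_succ_iff.2 le_rfl))
      rcases lt_or_ge k i₀ with hki | hki
      · have hkI : k ∈ I := hcut.initial k i₀ hki hi₀
        obtain ⟨β, hβ, h⟩ := toMem k hkI hk
        refine Or.inr ?_
        rcases h.succ (hunique k hkI) with h | h
        · exact ofMem _ β hβ h
        · refine ofMem _ _ (add_mem_substructure hβ ?_) h
          obtain ⟨p, hp, hpow⟩ := hel.exists_powTwo ⟨entry a k, (hmem _).2 ⟨k, hkI, rfl⟩⟩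
            (Arith.exists_powTwo _)
          rwa [← powTwo_iff.1 hpow]
      · exact Or.inl (lt_succ_iff.2 hki)
  obtain ⟨α, hα, h⟩ := toMem i₀ hi₀ ((key i₀).resolve_left (lt_irrefl i₀))
  refine ⟨α, hα, fun x => ?_⟩
  rw [codesInitial_iff.1 h x, ← hξ]
  refine ⟨fun hx => ⟨hx, ?_⟩, fun hx => hx.1⟩
  obtain ⟨i, hi, rfl⟩ := (hmem x).1 (hXM₀ hx)
  exact ⟨i, hXi₀ i hi hx, happ i hi⟩

end Main
end Arith

theorem lemma3p3 {M : Type*} [Arith.LA.Structure M] (hM : Arith.ModelsISigma1 M)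
    (I : Set M) (hI : Arith.IsStrongCut I)
    (a : M) (ha : a ∉ I)
    (hinj : ∀ i ∈ I, ∀ j ∈ I, i ≠ j → Arith.entry a i ≠ Arith.entry a j)
    (M₀ : Arith.LA.Substructure M)
    (hM₀ : (M₀ : Set M) = {z : M | ∃ i ∈ I, z = Arith.entry a i})
    (hel : Arith.IsSigma1Elementary M₀)
    (X : Set M) (hXM₀ : X ⊆ (M₀ : Set M)) (hX : Arith.IsCoded X)
    (i₀ : M) (hi₀ : i₀ ∈ I) (hXi₀ : ∀ i ∈ I, Arith.entry a i ∈ X → i < i₀) :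
    ∃ α : M₀, Arith.Codes α {x : M₀ | (x : M) ∈ X} ∧ Arith.Codes (α : M) X := by
  have : Fact (Arith.ModelsISigma1 M) := ⟨hM⟩
  obtain ⟨α, hα, h⟩ := Arith.exists_code_mem hI ha hinj hM₀ hel hXM₀ hX hi₀ hXi₀
  exact ⟨⟨α, hα⟩, fun x => (h x).trans (hel.ackMem_iff x ⟨α, hα⟩), h⟩
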